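/- **Theorem 2.1.** Let $k$ be a positive integer, let $D\subseteq\mathbb{C}$ be a domain (a non-empty connected open set), and let $a,b\in\mathbb{C}$ with $a\neq b$ and $b\neq 0$. Let $\mathcal F$ be a family of holomorphic functions on $D$ such that, for every $f\in\mathcal F$, all zeros of $f$ in $D$ have multiplicity at least $k$ (at a point near which $f$ vanishes identically, the multiplicity is taken to be $\infty$). Suppose that every $f\in\mathcal F$ satisfies: 1. $f$ and $f^{(k)}$ share the value $a$ IM in $D$, that is, $f-a$ and $f^{(k)}-a$ have the same zeros in $D$, ignoring multiplicities: for all $z\in D$, $f(z)=a$ if and only if $f^{(k)}(z)=a$; 2. for all $z\in D$, if $f^{(k)}(z)=b$ then $f(z)=b$. Then $\mathcal F$ is normal in $D$: every sequence in $\mathcal F$ has either a subsequence that converges, uniformly on each compact subset of $D$, to a finite-valued limit function $D\to\mathbb{C}$, or a subsequence that converges to $\infty$ uniformly on each compact subset of $D$. -/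

import Mathlib

open Filter

/-- A family `F` of functions is normal on `D`: every sequence in `F` has a subsequence that
converges to a finite-valued limit function uniformly on each compact subset of `D`, or a
subsequence that converges to `∞` uniformly on each compact subset of `D`. -/
def IsNormalFamilyOn (F : Set (ℂ → ℂ)) (D : Set ℂ) : Prop :=
  ∀ f : ℕ → ℂ → ℂ, (∀ n, f n ∈ F) →
    ∃ φ : ℕ → ℕ, StrictMono φ ∧
      ((∃ g : ℂ → ℂ, ∀ K : Set ℂ, K ⊆ D → IsCompact K →
          TendstoUniformlyOn (fun n => f (φ n)) g atTop K) ∨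
        (∀ K : Set ℂ, K ⊆ D → IsCompact K →
          ∀ M : ℝ, ∀ᶠ n in atTop, ∀ z ∈ K, M < ‖f (φ n) z‖))

/-- `f` and `g` share the value `a` on `D`, ignoring multiplicities (IM): `f - a` and `g - a` have
the same zeros in `D`. -/
def SharesValueIMOn (f g : ℂ → ℂ) (a : ℂ) (D : Set ℂ) : Prop :=
  ∀ z ∈ D, f z = a ↔ g z = a

/-- All zeros of `f` in `D` have multiplicity at least `k`. Multiplicity is the order of vanishing,
which is `⊤` for a function that vanishes identically near the point. -/
def ZerosMultiplicityGeOn (f : ℂ → ℂ) (k : ℕ) (D : Set ℂ) : Prop :=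
  ∀ z ∈ D, f z = 0 → (k : ℕ∞) ≤ analyticOrderAt f z

/-!
By Marty's theorem it suffices to bound the spherical derivatives of the family near each point of
`D`. If they are unbounded near a point, then the Zalcman–Pang lemma `exists_isZalcmanLimit` provides
rescalings `f n (z n + ρ n ζ) / ρ n ^ α` of members of the family that converge to a nonconstant entire
function `g` with bounded spherical derivative. By the Clunie–Hayman theorem
`exists_norm_le_exp_of_sphericalDeriv_le`, `g` and its derivatives have exponential type, so that one
of them which omits a value `c` has the form `c + exp (α ζ + β)`. The conditions on values of `f` and
`f⁽ᵏ⁾` pass to `g` by Hurwitz's theorem.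

* If `k ≥ 2` and `a ≠ 0`, take `α = 0`. The rescaled derivatives `ρ ^ k f⁽ᵏ⁾` turn both values `a` and
  `b` of `f⁽ᵏ⁾` into the value `0` of `g⁽ᵏ⁾`; as `a ≠ b`, `g` omits `a`. Then
  `g = a + exp (α ζ + β)` has simple zeros, whereas its zeros have multiplicity at least `k`.
* If `k = 1` or `a = 0`, take `α = k` and the functions `f - a`. Now `g = 0 ↔ g⁽ᵏ⁾ = a` and `g⁽ᵏ⁾`
  omits `b`. If `g⁽ᵏ⁾` is not constant, then `g⁽ᵏ⁾ = b + exp (α ζ + β)`, and `g` vanishes at the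
  infinitely many points where `exp (α ζ + β) = a - b`; there it equals a polynomial whose `k`-th
  derivative is `b ≠ 0`, which is impossible. If `g⁽ᵏ⁾` is constant, then `g` is a polynomial with a
  zero, hence `g⁽ᵏ⁾ = a`; this contradicts `g` being nonconstant if `a = 0`, and the normalization
  `sphericalDeriv g 0 ≥ ‖a‖ + 1` if `k = 1`.

Harnack's inequality for `log ‖f‖`, deduced from the Borel–Carathéodory theorem, underlies both
Marty's theorem (it spreads bounds along the connected set `D`) and the Clunie–Hayman theorem.
-/

open Metric Topology

/-! ### Harnack's inequality for `log ‖f‖` -/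

/-- The Borel–Carathéodory bound for `-H`, with the upper bound `M` for the real part tending to `0`. -/
theorem norm_le_mul_norm_of_re_nonneg {H : ℂ → ℂ} {c z : ℂ} {R : ℝ}
    (hH : DifferentiableOn ℂ H (ball c R)) (hre : ∀ w ∈ ball c R, 0 ≤ (H w).re)
    (hz : z ∈ ball c R) :
    ‖H z‖ ≤ (R + dist z c) / (R - dist z c) * ‖H c‖ := by
  have hd : dist z c < R := hz
  have hR : 0 < R := dist_nonneg.trans_lt hd
  have hmaps : ∀ w ∈ ball (0 : ℂ) R, c + w ∈ ball c R := fun w hw => by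
    simpa [dist_eq_norm] using hw
  have hd' : DifferentiableOn ℂ (fun w => -H (c + w)) (ball 0 R) :=
    (hH.comp (by fun_prop) hmaps).neg
  have key : ∀ M : ℝ, 0 < M → ‖H z‖ ≤ 2 * M * dist z c / (R - dist z c)
      + (R + dist z c) / (R - dist z c) * ‖H c‖ := by
    intro M hM
    have hzz : z - c ∈ ball (0 : ℂ) R := by simpa [dist_eq_norm] using hz
    have := Complex.borelCaratheodory hM hd' (fun w hw => by
      have := hre _ (hmaps w hw)
      simp only [Set.mem_ofPred_eq, Complex.neg_re]
      linarith) hR hzz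
    simp only [add_sub_cancel, norm_neg, add_zero, ← dist_eq_norm] at this
    calc ‖H z‖ ≤ _ := this
      _ = _ := by ring
  have hlim : Tendsto (fun M : ℝ => 2 * M * dist z c / (R - dist z c)
      + (R + dist z c) / (R - dist z c) * ‖H c‖) (𝓝[>] 0)
      (𝓝 (2 * 0 * dist z c / (R - dist z c) + (R + dist z c) / (R - dist z c) * ‖H c‖)) := by
    refine Tendsto.mono_left (Continuous.tendsto (by fun_prop) 0) nhdsWithin_le_nhds
  have := ge_of_tendsto hlim (eventually_mem_nhdsWithin.mono fun M hM => key M hM)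
  simpa using this


/-- A branch of the logarithm of a zero-free function whose logarithmic derivative has a primitive. -/
theorem exists_exp_eq_of_isExactOn {f : ℂ → ℂ} {U : Set ℂ} (hU : IsOpen U)
    (hUc : IsPreconnected U) (hf : DifferentiableOn ℂ f U) (h0 : ∀ w ∈ U, f w ≠ 0)
    (hex : Complex.IsExactOn (fun z => deriv f z / f z) U) {p : ℂ} (hp : p ∈ U) :
    ∃ H : ℂ → ℂ, DifferentiableOn ℂ H U ∧ ∀ w ∈ U, Complex.exp (H w) = f w := by
  obtain ⟨H, hHp, hH⟩ := hex.with_val_at p (Complex.log (f p))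
  refine ⟨H, fun w hw => (hH w hw).differentiableAt.differentiableWithinAt, fun w hw => ?_⟩
  have hder : ∀ x ∈ U, HasDerivAt (fun z => f z * Complex.exp (-H z)) 0 x := by
    intro x hx
    have h1 := (hf.differentiableAt (hU.mem_nhds hx)).hasDerivAt
    have h2 := (hH x hx).neg.cexp
    refine (h1.mul h2).congr_deriv ?_
    have := h0 x hx
    simp only [Pi.neg_apply]
    field_simp
    ring
  have hconst := hU.is_const_of_deriv_eq_zero hUc
    (fun x hx => (hder x hx).differentiableAt.differentiableWithinAt)
    (fun x hx => (hder x hx).deriv) hw hp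
  simp only [hHp, Complex.exp_neg, Complex.exp_log (h0 p hp), mul_inv_cancel₀ (h0 p hp)] at hconst
  have hne := Complex.exp_ne_zero (H w)
  field_simp at hconst
  exact hconst.symm

/-- A holomorphic function with real part `log ‖f‖`, normalized to be real at a chosen point `p`. -/
theorem exists_re_eq_log_norm {f : ℂ → ℂ} {c p : ℂ} {R : ℝ}
    (hf : DifferentiableOn ℂ f (ball c R)) (h0 : ∀ w ∈ ball c R, f w ≠ 0) (hp : p ∈ ball c R) :
    ∃ H : ℂ → ℂ, DifferentiableOn ℂ H (ball c R) ∧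
      (∀ w ∈ ball c R, (H w).re = Real.log ‖f w‖) ∧ (H p).im = 0 := by
  have hd : DifferentiableOn ℂ (fun z => deriv f z / f z) (ball c R) :=
    (hf.deriv isOpen_ball).div hf h0
  obtain ⟨H, hH, hexp⟩ := exists_exp_eq_of_isExactOn isOpen_ball
    (convex_ball c R).isPreconnected hf h0 hd.isExactOn_ball hp
  refine ⟨fun w => H w - (H p).im * Complex.I, hH.sub_const _, fun w hw => ?_, by simp⟩
  simp [← hexp w hw, Complex.norm_exp]

/-- The upper half of **Harnack's inequality** for the positive harmonic function `log ‖f‖`. -/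
theorem log_norm_le_mul_log_norm_center {f : ℂ → ℂ} {c z : ℂ} {R : ℝ}
    (hf : DifferentiableOn ℂ f (ball c R)) (h1 : ∀ w ∈ ball c R, 1 < ‖f w‖) (hz : z ∈ ball c R) :
    Real.log ‖f z‖ ≤ (R + dist z c) / (R - dist z c) * Real.log ‖f c‖ := by
  have hc : c ∈ ball c R := mem_ball_self (dist_nonneg.trans_lt hz)
  obtain ⟨H, hH, hre, him⟩ := exists_re_eq_log_norm hf
    (fun w hw h => by have := h1 w hw; rw [h, norm_zero] at this; linarith) hc
  have hpos : ∀ w ∈ ball c R, 0 ≤ (H w).re := fun w hw => by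
    rw [hre w hw]; exact Real.log_nonneg (h1 w hw).le
  have hHc : ‖H c‖ = Real.log ‖f c‖ := by
    rw [← hre c hc, ← Complex.abs_re_eq_norm.2 him, abs_of_nonneg (hpos c hc)]
  rw [← hre z hz, ← hHc]
  exact (Complex.re_le_norm _).trans (norm_le_mul_norm_of_re_nonneg hH hpos hz)

/-- The lower half of **Harnack's inequality** for `log ‖f‖`. If `H` has real part `log ‖f‖` and is
real at `z`, then `1 / H` also has positive real part, so it obeys `norm_le_mul_norm_of_re_nonneg`. -/
theorem log_norm_center_le_mul_log_norm {f : ℂ → ℂ} {c z : ℂ} {R : ℝ}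
    (hf : DifferentiableOn ℂ f (ball c R)) (h1 : ∀ w ∈ ball c R, 1 < ‖f w‖) (hz : z ∈ ball c R) :
    Real.log ‖f c‖ ≤ (R + dist z c) / (R - dist z c) * Real.log ‖f z‖ := by
  have hc : c ∈ ball c R := mem_ball_self (dist_nonneg.trans_lt hz)
  obtain ⟨H, hH, hre, him⟩ := exists_re_eq_log_norm hf
    (fun w hw h => by have := h1 w hw; rw [h, norm_zero] at this; linarith) hz
  have hpos : ∀ w ∈ ball c R, 0 < (H w).re := fun w hw => by
    rw [hre w hw]; exact Real.log_pos (h1 w hw)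
  have hne : ∀ w ∈ ball c R, H w ≠ 0 := fun w hw h => by
    have := hpos w hw; rw [h, Complex.zero_re] at this; exact lt_irrefl _ this
  have hHz : ‖H z‖ = Real.log ‖f z‖ := by
    rw [← hre z hz, ← Complex.abs_re_eq_norm.2 him, abs_of_nonneg (hpos z hz).le]
  have := norm_le_mul_norm_of_re_nonneg (H := fun w => (H w)⁻¹) (hH.inv hne) (fun w hw => by
    rw [Complex.inv_re]; exact div_nonneg (hpos w hw).le (Complex.normSq_nonneg _)) hz
  rw [norm_inv, norm_inv, ← div_eq_mul_inv, inv_eq_one_div,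
    div_le_div_iff₀ (norm_pos_iff.2 (hne z hz)) (norm_pos_iff.2 (hne c hc)), one_mul] at this
  rw [← hre c hc, ← hHz]
  exact (Complex.re_le_norm _).trans this

/-! ### The spherical derivative -/

/-- The spherical derivative `|f'| / (1 + |f|²)`. -/
noncomputable def sphericalDeriv (f : ℂ → ℂ) (z : ℂ) : ℝ := ‖deriv f z‖ / (1 + ‖f z‖ ^ 2)

/-- The height of `f` on the Riemann sphere, `‖f‖² / (1 + ‖f‖²)`, is Lipschitz with constant a bound
for the spherical derivative. -/
theorem abs_sub_le_of_sphericalDeriv_le {f : ℂ → ℂ} {U : Set ℂ} (hU : IsOpen U)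
    (hUc : Convex ℝ U) (hf : DifferentiableOn ℂ f U) {M : ℝ}
    (hM : ∀ w ∈ U, sphericalDeriv f w ≤ M) {w z : ℂ} (hw : w ∈ U) (hz : z ∈ U) :
    |‖f z‖ ^ 2 / (1 + ‖f z‖ ^ 2) - ‖f w‖ ^ 2 / (1 + ‖f w‖ ^ 2)| ≤ M * dist z w := by
  have hmem : ∀ t ∈ Set.Icc (0 : ℝ) 1, w + t * (z - w) ∈ U := fun t ht => by
    have := hUc.add_smul_sub_mem hw hz ht
    simpa using this
  set γ : ℝ → ℂ := fun t => f (w + t * (z - w)) with hγ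
  have hder : ∀ t ∈ Set.Icc (0 : ℝ) 1,
      HasDerivAt γ (deriv f (w + t * (z - w)) * (z - w)) t := by
    intro t ht
    have h1 : HasDerivAt (fun t : ℝ => w + t * (z - w)) (z - w) t := by
      simpa using ((Complex.ofRealCLM.hasDerivAt (x := t)).mul_const (z - w)).const_add w
    have h2 := (hf.differentiableAt (hU.mem_nhds (hmem t ht))).hasDerivAt
    exact h2.comp t h1
  set s : ℝ → ℝ := fun t => ‖γ t‖ ^ 2 / (1 + ‖γ t‖ ^ 2) with hs
  have hsder : ∀ t ∈ Set.Icc (0 : ℝ) 1, HasDerivAt s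
      (2 * inner ℝ (γ t) (deriv f (w + t * (z - w)) * (z - w)) / (1 + ‖γ t‖ ^ 2) ^ 2) t := by
    intro t ht
    have h1 := (hder t ht).norm_sq
    refine (h1.div (h1.const_add 1) (by positivity)).congr_deriv ?_
    congr 1
    ring
  have hb : ∀ t ∈ Set.Ico (0 : ℝ) 1,
      ‖2 * inner ℝ (γ t) (deriv f (w + t * (z - w)) * (z - w)) / (1 + ‖γ t‖ ^ 2) ^ 2‖
        ≤ M * dist z w := by
    intro t ht
    have hm := hM _ (hmem t (Set.Ico_subset_Icc_self ht))
    have hi := abs_real_inner_le_norm (γ t) (deriv f (w + t * (z - w)) * (z - w))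
    rw [norm_div, Real.norm_of_nonneg (by positivity : (0:ℝ) ≤ (1 + ‖γ t‖ ^ 2) ^ 2), norm_mul,
      Real.norm_eq_abs, Real.norm_eq_abs, abs_two]
    rw [norm_mul, ← dist_eq_norm] at hi
    unfold sphericalDeriv at hm
    change ‖deriv f (w + t * (z - w))‖ / (1 + ‖γ t‖ ^ 2) ≤ M at hm
    calc _ ≤ 2 * (‖γ t‖ * (‖deriv f (w + t * (z - w))‖ * dist z w)) / (1 + ‖γ t‖ ^ 2) ^ 2 := by
          gcongr
      _ = (2 * ‖γ t‖ / (1 + ‖γ t‖ ^ 2)) *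
            (‖deriv f (w + t * (z - w))‖ / (1 + ‖γ t‖ ^ 2)) * dist z w := by
          field_simp
      _ ≤ 1 * M * dist z w := by
          gcongr
          rw [div_le_one (by positivity)]
          nlinarith [sq_nonneg (‖γ t‖ - 1)]
      _ = _ := by ring
  have := norm_image_sub_le_of_norm_deriv_le_segment_01'
    (fun t ht => (hsder t ht).hasDerivWithinAt) hb
  simpa [hs, hγ] using this

/-- On discs of radius `1 / (4 M)` the height changes by at most `1 / 4`, so a value in the closed unit
disc forces all values into the disc of radius `2`; `half_le_norm_of_sphericalDeriv_le` is the
counterpart near `∞`. -/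
theorem norm_le_two_of_sphericalDeriv_le {f : ℂ → ℂ} {U : Set ℂ} (hU : IsOpen U)
    (hUc : Convex ℝ U) (hf : DifferentiableOn ℂ f U) {M : ℝ}
    (hM : ∀ w ∈ U, sphericalDeriv f w ≤ M) {w z : ℂ} (hw : w ∈ U) (hz : z ∈ U)
    (hd : M * dist z w ≤ 1 / 4) (h1 : ‖f w‖ ≤ 1) : ‖f z‖ ≤ 2 := by
  have h := (abs_le.1 (abs_sub_le_of_sphericalDeriv_le hU hUc hf hM hw hz)).2
  have h2 : ‖f w‖ ^ 2 / (1 + ‖f w‖ ^ 2) ≤ 1 / 2 := by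
    rw [div_le_div_iff₀ (by positivity) (by norm_num)]
    nlinarith [norm_nonneg (f w)]
  have h3 : ‖f z‖ ^ 2 / (1 + ‖f z‖ ^ 2) ≤ 3 / 4 := by linarith
  rw [div_le_div_iff₀ (by positivity) (by norm_num)] at h3
  nlinarith [norm_nonneg (f z)]

theorem half_le_norm_of_sphericalDeriv_le {f : ℂ → ℂ} {U : Set ℂ} (hU : IsOpen U)
    (hUc : Convex ℝ U) (hf : DifferentiableOn ℂ f U) {M : ℝ}
    (hM : ∀ w ∈ U, sphericalDeriv f w ≤ M) {w z : ℂ} (hw : w ∈ U) (hz : z ∈ U)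
    (hd : M * dist z w ≤ 1 / 4) (h1 : 1 ≤ ‖f w‖) : 1 / 2 ≤ ‖f z‖ := by
  have h := (abs_le.1 (abs_sub_le_of_sphericalDeriv_le hU hUc hf hM hw hz)).1
  have h2 : 1 / 2 ≤ ‖f w‖ ^ 2 / (1 + ‖f w‖ ^ 2) := by
    rw [div_le_div_iff₀ (by norm_num) (by positivity)]
    nlinarith [norm_nonneg (f w)]
  have h3 : 1 / 4 ≤ ‖f z‖ ^ 2 / (1 + ‖f z‖ ^ 2) := by linarith
  rw [div_le_div_iff₀ (by norm_num) (by positivity)] at h3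
  nlinarith [norm_nonneg (f z)]

/-! ### Entire functions with bounded spherical derivative -/

/-- **Clunie–Hayman theorem**: an entire function with bounded spherical derivative has exponential
type. At a point `z` with `‖g z‖ > 1`, let `w` be a nearest point of `{‖g‖ ≤ 1}` and `d` its distance.
Then `log ‖g‖` is positive harmonic on the disc `ball z d` and at most `log 2` at distance `δ` from
`w`, so Harnack's inequality bounds it at `z` by a multiple of `d`. -/
theorem exists_norm_le_exp_of_sphericalDeriv_le {g : ℂ → ℂ} (hg : Differentiable ℂ g) {M : ℝ}
    (hM : ∀ z, sphericalDeriv g z ≤ M) :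
    ∃ A : ℝ, 0 ≤ A ∧ ∀ z, ‖g z‖ ≤ Real.exp (A * (1 + ‖z‖)) := by
  wlog hMpos : 0 < M generalizing M
  · exact this (M := max M 1) (fun z => (hM z).trans (le_max_left _ _)) (by positivity)
  -- if `‖g‖ > 1` everywhere, Liouville's theorem for `1 / g` shows that `g` is constant
  by_cases hne : ∃ w₀, ‖g w₀‖ ≤ 1
  swap
  · push Not at hne
    obtain ⟨c, hc⟩ := (hg.inv (fun z h => by
        have := hne z; rw [h, norm_zero] at this; linarith)).exists_const_forall_eq_of_bounded (by
      refine (isBounded_iff_forall_norm_le.2 ⟨1, ?_⟩)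
      rintro _ ⟨z, rfl⟩
      simpa using inv_le_one_of_one_le₀ (hne z).le)
    refine ⟨‖c⁻¹‖, norm_nonneg _, fun z => ?_⟩
    have : g z = c⁻¹ := by rw [← hc z]; simp
    rw [this]
    nlinarith [Real.add_one_le_exp (‖c⁻¹‖ * (1 + ‖z‖)), norm_nonneg c⁻¹, norm_nonneg z,
      mul_nonneg (norm_nonneg c⁻¹) (norm_nonneg z)]
  obtain ⟨w₀, hw₀⟩ := hne
  set δ : ℝ := 1 / (4 * M) with hδ
  have hδpos : 0 < δ := by positivity
  have hδM : M * δ = 1 / 4 := by rw [hδ]; field_simp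
  refine ⟨2 * (1 + ‖w₀‖) / δ + 1, by positivity, fun z => ?_⟩
  have hlog2 : Real.log 2 ≤ 1 := by linarith [Real.log_two_lt_d9]
  have hexp1 : (2 : ℝ) ≤ Real.exp 1 := by linarith [Real.exp_one_gt_d9]
  have hbase : (2 : ℝ) ≤ Real.exp ((2 * (1 + ‖w₀‖) / δ + 1) * (1 + ‖z‖)) := by
    refine hexp1.trans (Real.exp_le_exp.2 ?_)
    have : 0 ≤ 2 * (1 + ‖w₀‖) / δ := by positivity
    nlinarith [norm_nonneg z]
  by_cases hz1 : ‖g z‖ ≤ 1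
  · linarith
  push Not at hz1
  have hcl : IsClosed {w | ‖g w‖ ≤ 1} := isClosed_le hg.continuous.norm continuous_const
  obtain ⟨w, hw, hdist⟩ := hcl.exists_infDist_eq_dist ⟨w₀, hw₀⟩ z
  have hw1 : ‖g w‖ ≤ 1 := hw
  set d := dist z w with hd
  have hball : ∀ p ∈ ball z d, 1 < ‖g p‖ := by
    intro p hp
    by_contra! hcon
    have h1 : infDist z {w | ‖g w‖ ≤ 1} ≤ dist z p := infDist_le_dist_of_mem hcon
    rw [hdist, dist_comm z p] at h1
    exact absurd hp (not_lt.2 h1)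
  have hdle : d ≤ ‖z‖ + ‖w₀‖ := by
    have h1 : infDist z {w | ‖g w‖ ≤ 1} ≤ dist z w₀ := infDist_le_dist_of_mem hw₀
    rw [hdist, dist_eq_norm z w₀] at h1
    exact h1.trans (norm_sub_le _ _)
  have hnear : ∀ p, dist p w ≤ δ → ‖g p‖ ≤ 2 := fun p hp =>
    norm_le_two_of_sphericalDeriv_le isOpen_univ convex_univ hg.differentiableOn
      (fun x _ => hM x) (Set.mem_univ w) (Set.mem_univ p)
      ((mul_le_mul_of_nonneg_left hp hMpos.le).trans hδM.le) hw1
  by_cases hdδ : d ≤ δ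
  · exact (hnear z hdδ).trans hbase
  push Not at hdδ
  have hdpos : 0 < d := hδpos.trans hdδ
  -- `p` lies on the segment from `w` to `z`, at distance `δ` from `w`
  set p : ℂ := w + ((δ / d : ℝ) : ℂ) * (z - w) with hp
  have hzw : ‖z - w‖ = d := by rw [hd, dist_eq_norm]
  have hpw : dist p w = δ := by
    rw [dist_eq_norm, hp, add_sub_cancel_left, norm_mul, Complex.norm_real, hzw,
      Real.norm_of_nonneg (by positivity)]
    field_simp
  have hpz : dist p z = d - δ := by
    have : p - z = -(((1 - δ / d : ℝ) : ℂ) * (z - w)) := by rw [hp]; push_cast; ring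
    have h1 : δ / d ≤ 1 := (div_le_one hdpos).2 hdδ.le
    rw [dist_eq_norm, this, norm_neg, norm_mul, Complex.norm_real, hzw,
      Real.norm_of_nonneg (by linarith)]
    field_simp
  have hpb : p ∈ ball z d := by rw [mem_ball, hpz]; linarith
  have hgp := hnear p hpw.le
  have hgp1 := hball p hpb
  have hH := log_norm_center_le_mul_log_norm hg.differentiableOn hball hpb
  rw [hpz] at hH
  have hlogp : Real.log ‖g p‖ ≤ 1 := (Real.log_le_log (by linarith) hgp).trans hlog2
  have hK : (d + (d - δ)) / (d - (d - δ)) ≤ 2 * d / δ := by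
    rw [sub_sub_cancel]; gcongr; linarith
  have : Real.log ‖g z‖ ≤ 2 * d / δ * 1 := hH.trans (by
    have : 0 ≤ Real.log ‖g p‖ := Real.log_nonneg hgp1.le
    gcongr)
  rw [← Real.log_le_iff_le_exp (by linarith)]
  refine this.trans ?_
  rw [mul_one]
  calc 2 * d / δ ≤ 2 * ((1 + ‖w₀‖) * (1 + ‖z‖)) / δ := by
        gcongr; nlinarith [norm_nonneg z, norm_nonneg w₀, mul_nonneg (norm_nonneg z) (norm_nonneg w₀)]
    _ = 2 * (1 + ‖w₀‖) / δ * (1 + ‖z‖) := by ring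
    _ ≤ _ := by gcongr; linarith

/-! ### Normality criteria of Montel and Marty -/

theorem dist_le_of_forall_norm_le {f : ℂ → ℂ} {z : ℂ} {r C : ℝ} (hr : 0 < r)
    (hf : DifferentiableOn ℂ f (ball z r)) (hC : ∀ w ∈ ball z r, ‖f w‖ ≤ C) {x y : ℂ}
    (hx : x ∈ ball z (r / 2)) (hy : y ∈ ball z (r / 2)) :
    dist (f x) (f y) ≤ C / (r / 4) * dist x y := by
  have hsub : ball z (r / 2) ⊆ ball z r := ball_subset_ball (by linarith)
  rw [dist_eq_norm, dist_eq_norm]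
  refine Convex.norm_image_sub_le_of_norm_deriv_le (s := ball z (r / 2))
    (fun w hw => hf.differentiableAt (isOpen_ball.mem_nhds (hsub hw))) (fun w hw => ?_)
    (convex_ball _ _) hy hx
  have hcb : closedBall w (r / 4) ⊆ ball z r := by
    refine closedBall_subset_ball' ?_
    rw [mem_ball] at hw
    linarith
  refine Complex.norm_deriv_le_of_forall_mem_sphere_norm_le (by linarith) ?_
    (fun v hv => hC v (hcb (sphere_subset_closedBall hv)))
  exact (hf.mono (by rw [closure_ball _ (by linarith)]; exact hcb)).diffContOnCl

/-- **Montel's theorem** for sequences that are, near each point, eventually holomorphic and uniformly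
bounded. A diagonal subsequence converges on a countable dense set, and local equi-Lipschitz bounds
spread the convergence. -/
theorem exists_subseq_tendstoLocallyUniformlyOn {D : Set ℂ} (hD : IsOpen D) {f : ℕ → ℂ → ℂ}
    (h : ∀ z ∈ D, ∃ r > 0, ∃ C : ℝ, ∀ᶠ n in atTop,
      DifferentiableOn ℂ (f n) (ball z r) ∧ ∀ w ∈ ball z r, ‖f n w‖ ≤ C) :
    ∃ φ : ℕ → ℕ, StrictMono φ ∧
      ∃ g : ℂ → ℂ, TendstoLocallyUniformlyOn (fun n => f (φ n)) g atTop D := by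
  classical
  set q := TopologicalSpace.denseSeq ℂ with hq
  have hB : ∀ i, ∃ B : ℝ, ∀ n, (if q i ∈ D then f n (q i) else 0) ∈ closedBall (0 : ℂ) B := by
    intro i
    by_cases hi : q i ∈ D
    · obtain ⟨r, hr, C, hC⟩ := h _ hi
      have : IsBoundedUnder (· ≤ ·) atTop (fun n => ‖f n (q i)‖) :=
        ⟨C, eventually_map.2 (hC.mono fun n hn => hn.2 _ (mem_ball_self hr))⟩
      obtain ⟨B, hB⟩ := this.bddAbove_range
      exact ⟨B, fun n => by simpa [hi] using hB ⟨n, rfl⟩⟩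
    · exact ⟨0, fun n => by simp [hi]⟩
  choose B hB using hB
  obtain ⟨a, -, φ, hφ, hlim⟩ := (isCompact_univ_pi fun i => isCompact_closedBall (0 : ℂ) (B i)).tendsto_subseq
    (x := fun n i => if q i ∈ D then f n (q i) else 0) (fun n i _ => hB i n)
  rw [tendsto_pi_nhds] at hlim
  have hlocal : ∀ z ∈ D, ∃ s > 0, UniformCauchySeqOn (fun n => f (φ n)) atTop (closedBall z s) := by
    intro z hz
    obtain ⟨r₁, hr₁, C, hC⟩ := h z hz
    obtain ⟨r₂, hr₂, hsub⟩ := Metric.isOpen_iff.1 hD z hz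
    set r := min r₁ r₂ with hrdef
    have hr : 0 < r := lt_min hr₁ hr₂
    set L := |C / (r / 4)| + 1 with hL
    have hLpos : 0 < L := by positivity
    have hlip : ∀ᶠ n in atTop, ∀ x ∈ ball z (r / 2), ∀ y ∈ ball z (r / 2),
        dist (f (φ n) x) (f (φ n) y) ≤ L * dist x y := by
      filter_upwards [hφ.tendsto_atTop.eventually hC] with n hn x hx y hy
      have hb : ball z r ⊆ ball z r₁ := ball_subset_ball (min_le_left _ _)
      refine (dist_le_of_forall_norm_le hr (hn.1.mono hb) (fun w hw => hn.2 w (hb hw)) hx hy).trans ?_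
      gcongr
      rw [hL]
      linarith [le_abs_self (C / (r / 4))]
    refine ⟨r / 4, by positivity, Metric.uniformCauchySeqOn_iff.2 fun ε hε => ?_⟩
    set η := ε / (4 * L) with hη
    have hηpos : 0 < η := by positivity
    obtain ⟨t, ht⟩ := (isCompact_closedBall z (r / 4)).elim_finite_subcover
      (fun i : {i // q i ∈ ball z (r / 2)} => ball (q i) η) (fun _ => isOpen_ball) (by
        intro x hx
        have hx2 : x ∈ ball z (r / 2) := closedBall_subset_ball (by linarith) hx
        obtain ⟨_, ⟨hi1, hi2⟩, i, rfl⟩ := (TopologicalSpace.denseRange_denseSeq ℂ).inter_open_nonempty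
          (ball z (r / 2) ∩ ball x η) (isOpen_ball.inter isOpen_ball) ⟨x, hx2, mem_ball_self hηpos⟩
        exact Set.mem_iUnion.2 ⟨⟨i, hi1⟩, by rw [mem_ball, dist_comm]; exact hi2⟩)
    have hqD : ∀ i : {i // q i ∈ ball z (r / 2)}, q i ∈ D := fun i =>
      hsub (ball_subset_ball (by linarith [min_le_right r₁ r₂]) i.2)
    have hev : ∀ i ∈ t, ∃ N, ∀ m ≥ N, ∀ n ≥ N, dist (f (φ m) (q i)) (f (φ n) (q i)) < ε / 2 := by
      intro i _
      have hi := (hlim i.1).cauchySeq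
      obtain ⟨N, hN⟩ := Metric.cauchySeq_iff.1 hi (ε / 2) (by positivity)
      refine ⟨N, fun m hm n hn => ?_⟩
      have := hN m hm n hn
      simpa [hqD i] using this
    choose! N hN using hev
    obtain ⟨N₀, hN₀⟩ := eventually_atTop.1 hlip
    refine ⟨max N₀ (t.sup N), fun m hm n hn x hx => ?_⟩
    obtain ⟨i, hi, hxi⟩ : ∃ i ∈ t, x ∈ ball (q i) η := by simpa using ht hx
    have hx2 : x ∈ ball z (r / 2) := closedBall_subset_ball (by linarith) hx
    have h1 := hN₀ m (le_of_max_le_left hm) x hx2 _ i.2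
    have h2 := hN₀ n (le_of_max_le_left hn) _ i.2 x hx2
    have h3 := hN i hi m ((Finset.le_sup hi).trans (le_of_max_le_right hm)) n
      ((Finset.le_sup hi).trans (le_of_max_le_right hn))
    have hxi' : L * dist x (q i) < ε / 4 := by
      have : L * η = ε / 4 := by rw [hη]; field_simp
      rw [← this]
      exact mul_lt_mul_of_pos_left hxi hLpos
    rw [dist_comm (q i) x] at h2
    have := dist_triangle4 (f (φ m) x) (f (φ m) (q i)) (f (φ n) (q i)) (f (φ n) x)
    linarith
  have hpt : ∀ z ∈ D, ∃ l, Tendsto (fun n => f (φ n) z) atTop (𝓝 l) := by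
    intro z hz
    obtain ⟨s, hs, hc⟩ := hlocal z hz
    exact cauchySeq_tendsto_of_complete (hc.cauchySeq (mem_closedBall_self hs.le))
  choose! g hg using hpt
  refine ⟨φ, hφ, g, fun u hu z hz => ?_⟩
  obtain ⟨s, hs, hc⟩ := hlocal z hz
  obtain ⟨r₂, hr₂, hsub⟩ := Metric.isOpen_iff.1 hD z hz
  have hc' := (hc.mono (s' := closedBall z s ∩ D) Set.inter_subset_left).tendstoUniformlyOn_of_tendsto (f := g)
    (fun x hx => hg x hx.2)
  exact ⟨_, Filter.inter_mem (mem_nhdsWithin_of_mem_nhds (closedBall_mem_nhds z hs))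
    self_mem_nhdsWithin, hc' u hu⟩

/-- Under a bound on the spherical derivatives, boundedness at one point of a small disc spreads to
the disc: there each function either is bounded by `2`, or is bounded below by `1 / 2` and Harnack's
inequality for `log ‖4 f‖` applies. -/
theorem exists_ball_forall_norm_le {f : ℕ → ℂ → ℂ} {z : ℂ} {r M : ℝ} (hr : 0 < r)
    (h : ∀ᶠ n in atTop, DifferentiableOn ℂ (f n) (ball z r) ∧
      ∀ w ∈ ball z r, sphericalDeriv (f n) w ≤ M) :
    ∃ s > 0, s ≤ r ∧ ∀ C : ℝ, ∃ C' : ℝ, ∀ᶠ n in atTop, ∀ p ∈ ball z s, ‖f n p‖ ≤ C →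
      ∀ w ∈ ball z s, ‖f n w‖ ≤ C' := by
  set M' := max M 1 with hM'
  have hM'pos : 0 < M' := by positivity
  set t := min r (1 / (4 * M')) with ht
  have htpos : 0 < t := lt_min hr (by positivity)
  have htM : M' * t ≤ 1 / 4 := by
    calc M' * t ≤ M' * (1 / (4 * M')) := by gcongr; exact min_le_right _ _
      _ = 1 / 4 := by field_simp
  refine ⟨t / 4, by positivity, by linarith [min_le_left r (1 / (4 * M'))], fun C =>
    ⟨max 2 ((4 * C) ^ 5), ?_⟩⟩
  filter_upwards [h] with n hn p hp hpC w hw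
  have hbr : ball z t ⊆ ball z r := ball_subset_ball (min_le_left _ _)
  have hd := hn.1.mono hbr
  have hsd : ∀ w ∈ ball z t, sphericalDeriv (f n) w ≤ M' := fun w hw =>
    (hn.2 w (hbr hw)).trans (le_max_left _ _)
  have hdist : ∀ v ∈ ball z t, M' * dist v z ≤ 1 / 4 := fun v hv =>
    (mul_le_mul_of_nonneg_left (le_of_lt hv) hM'pos.le).trans htM
  have hw' : w ∈ ball z t := ball_subset_ball (by linarith) hw
  rcases le_total ‖f n z‖ 1 with h1 | h1
  · exact (norm_le_two_of_sphericalDeriv_le isOpen_ball (convex_ball _ _) hd hsd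
      (mem_ball_self htpos) hw' (hdist w hw') h1).trans (le_max_left _ _)
  · have hlow : ∀ v ∈ ball z t, 1 / 2 ≤ ‖f n v‖ := fun v hv =>
      half_le_norm_of_sphericalDeriv_le isOpen_ball (convex_ball _ _) hd hsd
        (mem_ball_self htpos) hv (hdist v hv) h1
    rw [mem_ball] at hp hw
    have hpsub : ball p (3 * t / 4) ⊆ ball z t := ball_subset_ball' (by linarith)
    have hwp : dist w p < t / 2 := by
      have := dist_triangle_right w p z
      linarith
    have hnorm : ∀ v, ‖4 * f n v‖ = 4 * ‖f n v‖ := fun v => by simp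
    have hH := log_norm_le_mul_log_norm_center (f := fun v => 4 * f n v)
      ((hd.mono hpsub).const_mul 4) (fun v hv => by
        rw [hnorm]; linarith [hlow v (hpsub hv)]) (z := w) (by rw [mem_ball]; linarith)
    have hplow := hlow p (hpsub (mem_ball_self (by linarith)))
    have hwlow := hlow w hw'
    have hK : (3 * t / 4 + dist w p) / (3 * t / 4 - dist w p) ≤ 5 := by
      rw [div_le_iff₀ (by linarith)]
      linarith
    rw [hnorm, hnorm] at hH
    have h5 : Real.log (4 * ‖f n w‖) ≤ Real.log ((4 * ‖f n p‖) ^ 5) := by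
      rw [Real.log_pow]
      refine hH.trans ?_
      have : 0 ≤ Real.log (4 * ‖f n p‖) := Real.log_nonneg (by linarith)
      push_cast
      gcongr
    rw [Real.log_le_log_iff (by linarith) (by positivity)] at h5
    have : (4 * ‖f n p‖) ^ 5 ≤ (4 * C) ^ 5 := by gcongr
    exact (by linarith [norm_nonneg (f n w)] : ‖f n w‖ ≤ (4 * C) ^ 5).trans (le_max_right _ _)

/-- **Marty's theorem** for sequences that are, near each point, eventually holomorphic with uniformly
bounded spherical derivatives. Pointwise boundedness along a subsequence spreads over the connected
set `D`, so either some subsequence is locally bounded, or the sequence tends to `∞`. -/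
theorem exists_subseq_of_sphericalDeriv_le {D : Set ℂ} (hD : IsOpen D) (hDc : IsConnected D)
    {f : ℕ → ℂ → ℂ}
    (h : ∀ z ∈ D, ∃ r > 0, ∃ M : ℝ, ∀ᶠ n in atTop,
      DifferentiableOn ℂ (f n) (ball z r) ∧ ∀ w ∈ ball z r, sphericalDeriv (f n) w ≤ M) :
    ∃ φ : ℕ → ℕ, StrictMono φ ∧
      ((∃ g : ℂ → ℂ, TendstoLocallyUniformlyOn (fun n => f (φ n)) g atTop D) ∨
        ∀ z ∈ D, ∃ s > 0, ∀ C : ℝ, ∀ᶠ n in atTop, ∀ w ∈ ball z s, C < ‖f (φ n) w‖) := by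
  have hloc : ∀ z ∈ D, ∃ s > 0, (∀ᶠ n in atTop, DifferentiableOn ℂ (f n) (ball z s)) ∧
      ∀ C : ℝ, ∃ C' : ℝ, ∀ᶠ n in atTop, ∀ p ∈ ball z s, ‖f n p‖ ≤ C →
        ∀ w ∈ ball z s, ‖f n w‖ ≤ C' := by
    intro z hz
    obtain ⟨r, hr, M, hM⟩ := h z hz
    obtain ⟨s, hs, hsr, hC⟩ := exists_ball_forall_norm_le hr hM
    exact ⟨s, hs, hM.mono fun n hn => hn.1.mono (ball_subset_ball hsr), hC⟩
  have hprop : ∀ ψ : ℕ → ℕ, StrictMono ψ → ∀ x ∈ D, ∀ y ∈ D,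
      (∃ C : ℝ, ∀ᶠ n in atTop, ‖f (ψ n) x‖ ≤ C) → ∃ C : ℝ, ∀ᶠ n in atTop, ‖f (ψ n) y‖ ≤ C := by
    intro ψ hψ x hx y hy
    refine (hDc.isPreconnected.induction₂ (fun x y =>
      (∃ C : ℝ, ∀ᶠ n in atTop, ‖f (ψ n) x‖ ≤ C) ↔ ∃ C : ℝ, ∀ᶠ n in atTop, ‖f (ψ n) y‖ ≤ C)
      ?_ (fun _ _ _ _ _ _ h1 h2 => h1.trans h2) (fun _ _ _ _ h => h.symm) hx hy).1
    intro z hz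
    obtain ⟨s, hs, -, hC⟩ := hloc z hz
    filter_upwards [mem_nhdsWithin_of_mem_nhds (ball_mem_nhds z hs)] with w hw
    have key : ∀ p ∈ ball z s, ∀ p' ∈ ball z s, (∃ C : ℝ, ∀ᶠ n in atTop, ‖f (ψ n) p‖ ≤ C) →
        ∃ C : ℝ, ∀ᶠ n in atTop, ‖f (ψ n) p'‖ ≤ C := by
      rintro p hp p' hp' ⟨C, hCp⟩
      obtain ⟨C', hC'⟩ := hC C
      refine ⟨C', ?_⟩
      filter_upwards [hψ.tendsto_atTop.eventually hC', hCp] with n hn hn'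
      exact hn p hp hn' p' hp'
    exact ⟨key z (mem_ball_self hs) w hw, key w hw z (mem_ball_self hs)⟩
  obtain ⟨p₀, hp₀⟩ := hDc.nonempty
  by_cases hcase : ∃ C : ℝ, ∃ᶠ n in atTop, ‖f n p₀‖ ≤ C
  · obtain ⟨C, hC⟩ := hcase
    obtain ⟨ψ, hψ, hψC⟩ := extraction_of_frequently_atTop hC
    obtain ⟨φ, hφ, g, hg⟩ := exists_subseq_tendstoLocallyUniformlyOn hD (f := fun n => f (ψ n)) (by
      intro z hz
      obtain ⟨s, hs, hdiff, hbd⟩ := hloc z hz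
      obtain ⟨C₁, hC₁⟩ := hprop ψ hψ p₀ hp₀ z hz ⟨C, Eventually.of_forall hψC⟩
      obtain ⟨C₂, hC₂⟩ := hbd C₁
      refine ⟨s, hs, C₂, ?_⟩
      filter_upwards [hψ.tendsto_atTop.eventually hdiff, hC₁, hψ.tendsto_atTop.eventually hC₂]
        with n h1 h2 h3
      exact ⟨h1, h3 z (mem_ball_self hs) h2⟩)
    exact ⟨ψ ∘ φ, hψ.comp hφ, Or.inl ⟨g, hg⟩⟩
  · refine ⟨id, strictMono_id, Or.inr fun z hz => ?_⟩
    obtain ⟨s, hs, -, hbd⟩ := hloc z hz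
    refine ⟨s, hs, fun C => ?_⟩
    by_contra hcon
    obtain ⟨C', hC'⟩ := hbd C
    have hfreq : ∃ᶠ n in atTop, ‖f n z‖ ≤ C' := by
      refine ((not_eventually.1 hcon).and_eventually hC').mono ?_
      rintro n ⟨h1, h2⟩
      push Not at h1
      obtain ⟨w, hw, hwC⟩ := h1
      exact h2 w hw hwC z (mem_ball_self hs)
    obtain ⟨ψ, hψ, hψC⟩ := extraction_of_frequently_atTop hfreq
    obtain ⟨C₁, hC₁⟩ := hprop ψ hψ z hz p₀ hp₀ ⟨C', Eventually.of_forall hψC⟩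
    exact hcase ⟨C₁, hψ.tendsto_atTop.frequently hC₁.frequently⟩

/-! ### Hurwitz's theorem -/

/-- **Hurwitz's theorem**: if `G n → g` locally uniformly and `g` is not constant near `ζ₀`, then
values `c n → g ζ₀` are attained by `G n` near `ζ₀`. -/
theorem eventually_exists_mem_ball_eq {G : ℕ → ℂ → ℂ} {g : ℂ → ℂ} {ζ₀ : ℂ} {R : ℝ} (hR : 0 < R)
    (hd : ∀ᶠ n in atTop, DifferentiableOn ℂ (G n) (ball ζ₀ R))
    (hlim : TendstoLocallyUniformlyOn G g atTop (ball ζ₀ R))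
    (hne : ¬ ∀ᶠ ζ in 𝓝 ζ₀, g ζ = g ζ₀) {c : ℕ → ℂ} (hc : Tendsto c atTop (𝓝 (g ζ₀)))
    {ε : ℝ} (hε : 0 < ε) : ∀ᶠ n in atTop, ∃ ζ ∈ ball ζ₀ ε, G n ζ = c n := by
  have hg : DifferentiableOn ℂ g (ball ζ₀ R) := hlim.differentiableOn hd isOpen_ball
  have hga : AnalyticAt ℂ g ζ₀ := hg.analyticAt (ball_mem_nhds ζ₀ hR)
  have h1 := (hga.eventually_eq_or_eventually_ne analyticAt_const).resolve_left hne
  rw [eventually_nhdsWithin_iff, Metric.eventually_nhds_iff] at h1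
  obtain ⟨s₁, hs₁, hs₁'⟩ := h1
  set s := min (min s₁ ε) R / 2 with hs
  have hmin : 0 < min (min s₁ ε) R := lt_min (lt_min hs₁ hε) hR
  have hspos : 0 < s := by positivity
  have hss : s < min (min s₁ ε) R := by rw [hs]; linarith
  have hsR : s < R := hss.trans_le (min_le_right _ _)
  have hsε : s < ε := hss.trans_le ((min_le_left _ _).trans (min_le_right _ _))
  have hss₁ : s < s₁ := hss.trans_le ((min_le_left _ _).trans (min_le_left _ _))
  have hcb : closedBall ζ₀ s ⊆ ball ζ₀ R := closedBall_subset_ball hsR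
  have hcont : ContinuousOn (fun ζ => ‖g ζ - g ζ₀‖) (sphere ζ₀ s) :=
    ((hg.continuousOn.mono (sphere_subset_closedBall.trans hcb)).sub continuousOn_const).norm
  obtain ⟨ζ₁, hζ₁, hmin₁⟩ := (isCompact_sphere ζ₀ s).exists_isMinOn
    (NormedSpace.sphere_nonempty.2 hspos.le) hcont
  set m := ‖g ζ₁ - g ζ₀‖ with hm
  have hmpos : 0 < m := norm_pos_iff.2 (sub_ne_zero.2
    (hs₁' (by rw [mem_sphere.1 hζ₁]; exact hss₁) (ne_of_mem_sphere hζ₁ hspos.ne')))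
  have hunif := (tendstoLocallyUniformlyOn_iff_forall_isCompact isOpen_ball).1 hlim _ hcb
    (isCompact_closedBall ζ₀ s)
  filter_upwards [hd, Metric.tendstoUniformlyOn_iff.1 hunif (m / 8) (by positivity),
    Metric.tendsto_nhds.1 hc (m / 8) (by positivity)] with n hdn hun hcn
  have hctr := hun ζ₀ (mem_closedBall_self hspos.le)
  have hsph : ∀ ζ ∈ sphere ζ₀ s, m / 2 ≤ ‖G n ζ - G n ζ₀‖ := by
    intro ζ hζ
    have h2 := hun ζ (sphere_subset_closedBall hζ)
    have h3 : m ≤ dist (g ζ) (g ζ₀) := by rw [dist_eq_norm]; exact hmin₁ hζ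
    have h4 := dist_triangle4 (g ζ) (G n ζ) (G n ζ₀) (g ζ₀)
    rw [dist_comm (G n ζ₀) (g ζ₀)] at h4
    rw [← dist_eq_norm]
    linarith
  have hfreq : ∃ᶠ ζ in 𝓝 ζ₀, G n ζ ≠ G n ζ₀ := by
    intro hev
    simp only [not_not] at hev
    have := (hdn.analyticOnNhd isOpen_ball).eqOn_of_preconnected_of_eventuallyEq
      analyticOnNhd_const (convex_ball ζ₀ R).isPreconnected (mem_ball_self hR) hev
    have h5 := hsph ζ₁ hζ₁
    rw [this (hcb (sphere_subset_closedBall hζ₁)), sub_self, norm_zero] at h5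
    linarith
  have hdc : DiffContOnCl ℂ (G n) (ball ζ₀ s) :=
    (hdn.mono (by rw [closure_ball _ hspos.ne']; exact hcb)).diffContOnCl
  have hcball : c n ∈ ball (G n ζ₀) (m / 2 / 2) := by
    have := dist_triangle (c n) (g ζ₀) (G n ζ₀)
    rw [mem_ball]
    linarith
  obtain ⟨ζ, hζ, hζc⟩ := hdc.ball_subset_image_closedBall hspos hsph hfreq hcball
  exact ⟨ζ, closedBall_subset_ball hsε hζ, hζc⟩

/-- Converse to Hurwitz's theorem: values attained near `ζ₀` along the sequence pass to the limit. -/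
theorem eq_of_eventually_exists_mem_ball_eq {G : ℕ → ℂ → ℂ} {g : ℂ → ℂ} {ζ₀ d : ℂ}
    (hlim : TendstoLocallyUniformlyOn G g atTop Set.univ) (hg : ContinuousAt g ζ₀)
    {c : ℕ → ℂ} (hc : Tendsto c atTop (𝓝 d))
    (h : ∀ ε > 0, ∀ᶠ n in atTop, ∃ ζ ∈ ball ζ₀ ε, G n ζ = c n) : g ζ₀ = d := by
  refine eq_of_forall_dist_le fun ε hε => ?_
  obtain ⟨t, ht, hun⟩ := Metric.tendstoLocallyUniformlyOn_iff.1 hlim (ε / 3) (by positivity) ζ₀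
    (Set.mem_univ _)
  rw [nhdsWithin_univ] at ht
  obtain ⟨s, hs, hst⟩ := Metric.mem_nhds_iff.1 (Filter.inter_mem ht
    (Metric.continuousAt_iff'.1 hg (ε / 3) (by positivity)))
  obtain ⟨n, h1, h2, ζ, hζ, h3⟩ :=
    (hun.and ((Metric.tendsto_nhds.1 hc (ε / 3) (by positivity)).and (h s hs))).exists
  have h4 := h1 ζ (hst hζ).1
  have h5 : dist (g ζ) (g ζ₀) < ε / 3 := (hst hζ).2
  have h6 := dist_triangle4 (g ζ₀) (g ζ) (c n) d
  rw [h3] at h4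
  rw [dist_comm (g ζ₀) (g ζ)] at h6
  linarith

/-! ### Rescaling -/

/-- Point picking: starting from a point and a scale that satisfy `P`, pass to a pair with at most half
the scale nearby as long as there is one. The distances travelled form a geometric series, and the
process stops because the scales that satisfy `P` are bounded below. -/
theorem exists_almost_minimal_scale {X : Type*} [PseudoMetricSpace X] {P : X → ℝ → Prop}
    {x₀ : X} {ρ₀ N δ : ℝ} (hN : 0 < N) (hδ : 0 < δ) (hρ₀ : 0 < ρ₀) (h₀ : P x₀ ρ₀)
    (hP : ∀ x ρ, dist x x₀ ≤ 2 * N * ρ₀ → 0 < ρ → P x ρ → δ ≤ ρ) :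
    ∃ x ρ, 0 < ρ ∧ ρ ≤ ρ₀ ∧ dist x x₀ ≤ 2 * N * ρ₀ ∧ P x ρ ∧
      ∀ y, dist y x ≤ N * ρ → ∀ ρ', 0 < ρ' → ρ' ≤ ρ / 2 → ¬ P y ρ' := by
  have key : ∀ n : ℕ, ∀ x ρ, 0 < ρ → ρ ≤ ρ₀ → dist x x₀ ≤ 2 * N * (ρ₀ - ρ) → P x ρ →
      ρ < 2 ^ n * δ → ∃ x ρ, 0 < ρ ∧ ρ ≤ ρ₀ ∧ dist x x₀ ≤ 2 * N * ρ₀ ∧ P x ρ ∧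
      ∀ y, dist y x ≤ N * ρ → ∀ ρ', 0 < ρ' → ρ' ≤ ρ / 2 → ¬ P y ρ' := by
    intro n
    induction n with
    | zero =>
      intro x ρ hρ hρ₀ hx hPx hlt
      have := hP x ρ (hx.trans (by nlinarith)) hρ hPx
      linarith
    | succ n ih =>
      intro x ρ hρ hρ₀ hx hPx hlt
      by_cases hgood : ∀ y, dist y x ≤ N * ρ → ∀ ρ', 0 < ρ' → ρ' ≤ ρ / 2 → ¬ P y ρ'
      · exact ⟨x, ρ, hρ, hρ₀, hx.trans (by nlinarith), hPx, hgood⟩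
      · push Not at hgood
        obtain ⟨y, hy, ρ', hρ', hle, hPy⟩ := hgood
        refine ih y ρ' hρ' (by linarith) ?_ hPy (by rw [pow_succ] at hlt; linarith)
        have := dist_triangle y x x₀
        nlinarith
  obtain ⟨n, hn⟩ := pow_unbounded_of_one_lt (ρ₀ / δ) (one_lt_two : (1 : ℝ) < 2)
  exact key n x₀ ρ₀ hρ₀ le_rfl (by simp) h₀ ((div_lt_iff₀ hδ).1 hn)

/-- The spherical derivative at `0` of `ζ ↦ f (z + ρ ζ) / ρ ^ α`. -/
noncomputable def scaledSphericalDeriv (α : ℕ) (f : ℂ → ℂ) (z : ℂ) (ρ : ℝ) : ℝ :=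
  ρ ^ (α + 1) * ‖deriv f z‖ / (ρ ^ (2 * α) + ‖f z‖ ^ 2)

theorem iteratedDeriv_rescale (j α : ℕ) (f : ℂ → ℂ) (z : ℂ) (ρ : ℝ) (ζ : ℂ) :
    iteratedDeriv j (fun ζ => f (z + ρ * ζ) / (ρ : ℂ) ^ α) ζ =
      (ρ : ℂ) ^ j / (ρ : ℂ) ^ α * iteratedDeriv j f (z + ρ * ζ) := by
  induction j generalizing ζ with
  | zero => simp [div_eq_inv_mul]
  | succ j ih =>
    rw [iteratedDeriv_succ, funext ih, iteratedDeriv_succ, deriv_const_mul_field,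
      deriv_comp_mul_left (ρ : ℂ) (fun x => iteratedDeriv j f (z + x)), deriv_comp_const_add,
      smul_eq_mul]
    ring

theorem sphericalDeriv_rescale (α : ℕ) (f : ℂ → ℂ) (z : ℂ) {ρ : ℝ} (hρ : 0 < ρ) (ζ : ℂ) :
    sphericalDeriv (fun ζ => f (z + ρ * ζ) / (ρ : ℂ) ^ α) ζ =
      scaledSphericalDeriv α f (z + ρ * ζ) ρ := by
  have := iteratedDeriv_rescale 1 α f z ρ ζ
  rw [iteratedDeriv_one, iteratedDeriv_one] at this
  unfold sphericalDeriv scaledSphericalDeriv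
  rw [this, norm_mul, norm_div, norm_div, norm_pow, norm_pow, Complex.norm_real,
    Real.norm_of_nonneg hρ.le, pow_mul']
  field_simp
  ring

theorem scaledSphericalDeriv_le_half (α : ℕ) (f : ℂ → ℂ) (z : ℂ) {ρ : ℝ} (hρ : 0 < ρ) :
    scaledSphericalDeriv α f z ρ ≤ 2 ^ (α + 1) * scaledSphericalDeriv α f z (ρ / 2) := by
  unfold scaledSphericalDeriv
  rw [← mul_div_assoc, ← mul_assoc, ← mul_pow, mul_div_cancel₀ _ (two_ne_zero)]
  gcongr
  linarith

theorem sphericalDeriv_le_of_lt_norm {f : ℂ → ℂ} {z : ℂ} {s C : ℝ} (hs : 0 < s) (hC : 0 < C)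
    (hf : DifferentiableOn ℂ f (ball z s)) (h : ∀ w ∈ ball z s, C < ‖f w‖) :
    sphericalDeriv f z ≤ 2 / (C * s) := by
  have h0 : ∀ w ∈ ball z s, f w ≠ 0 := fun w hw => norm_pos_iff.1 (hC.trans (h w hw))
  have hcb : closedBall z (s / 2) ⊆ ball z s := closedBall_subset_ball (by linarith)
  have hinv : DifferentiableOn ℂ (fun w => (f w)⁻¹) (ball z s) := hf.inv h0
  have hz : z ∈ ball z s := mem_ball_self hs
  have hd := Complex.norm_deriv_le_of_forall_mem_sphere_norm_le (f := fun w => (f w)⁻¹) (c := z)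
    (R := s / 2) (C := 1 / C) (by linarith)
    (hinv.mono (by rw [closure_ball _ (by linarith)]; exact hcb)).diffContOnCl (fun w hw => by
      rw [norm_inv, ← one_div]
      have := h w (hcb (sphere_subset_closedBall hw))
      gcongr)
  rw [deriv_fun_inv'' (hf.differentiableAt (ball_mem_nhds z hs)) (h0 z hz), norm_div, norm_neg,
    norm_pow] at hd
  have hpos : 0 < ‖f z‖ := norm_pos_iff.2 (h0 z hz)
  calc sphericalDeriv f z ≤ ‖deriv f z‖ / ‖f z‖ ^ 2 := by
        unfold sphericalDeriv; gcongr; linarith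
    _ ≤ 1 / C / (s / 2) := hd
    _ = 2 / (C * s) := by field_simp

/-- `g` is the locally uniform limit on `ℂ` of the rescalings `ζ ↦ f n (z n + ρ n ζ) / ρ n ^ α` of
members `f n` of `𝓕`, with scales `ρ n → 0`. For each `ζ` in a bounded set the points `z n + ρ n ζ`
are only required to lie in `U` for large `n`. -/
structure IsZalcmanLimit (α : ℕ) (𝓕 : Set (ℂ → ℂ)) (U : Set ℂ) (f : ℕ → ℂ → ℂ) (z : ℕ → ℂ)
    (ρ : ℕ → ℝ) (g : ℂ → ℂ) : Prop where
  mem : ∀ n, f n ∈ 𝓕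
  pos : ∀ n, 0 < ρ n
  tendsto_zero : Tendsto ρ atTop (𝓝 0)
  eventually_mem : ∀ R : ℝ, ∀ᶠ n in atTop, ∀ ζ ∈ ball (0 : ℂ) R, z n + ρ n * ζ ∈ U
  tendsto : TendstoLocallyUniformlyOn (fun n ζ => f n (z n + ρ n * ζ) / (ρ n : ℂ) ^ α) g atTop
    Set.univ

/-- The finite stage of the Zalcman–Pang lemma: a point and a scale at which the scaled spherical
derivative is at least `B`, while at the same scale it is bounded on the disc of rescaled radius
`1 / (2 ε)`. -/
theorem exists_rescaling {α : ℕ} {𝓕 : Set (ℂ → ℂ)} {z₀ : ℂ} {r B : ℝ}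
    (hsmall : ∀ f ∈ 𝓕, ∀ z ∈ ball z₀ r, ∃ δ > 0, ∀ᶠ w in 𝓝 z, ∀ ρ, 0 < ρ → ρ < δ →
      scaledSphericalDeriv α f w ρ < B)
    (hunb : ∀ s > 0, ∀ M : ℝ, ∃ f ∈ 𝓕, ∃ p ∈ ball z₀ s, M < sphericalDeriv f p)
    {ε : ℝ} (hε : 0 < ε) (hε1 : ε ≤ 1) (hεr : 2 * ε ≤ r) :
    ∃ f ∈ 𝓕, ∃ z, ∃ ρ : ℝ, dist z z₀ ≤ 2 * ε ∧ 0 < ρ ∧ ρ ≤ ε ∧ B ≤ scaledSphericalDeriv α f z ρ ∧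
      ∀ ζ ∈ ball (0 : ℂ) (1 / (2 * ε)), scaledSphericalDeriv α f (z + ρ * ζ) ρ ≤ 2 ^ (α + 1) * B := by
  obtain ⟨f, hf, p, hp, hMp⟩ := hunb ε hε (B / (ε ^ 2) ^ (α + 1))
  rw [mem_ball] at hp
  have hcb : closedBall p ε ⊆ ball z₀ r := closedBall_subset_ball' (by linarith)
  obtain ⟨δ, hδ, hδB⟩ : ∃ δ > 0, ∀ w ∈ closedBall p ε, ∀ ρ, 0 < ρ → ρ < δ →
      scaledSphericalDeriv α f w ρ < B := by
    refine (isCompact_closedBall p ε).induction_on (p := fun s => ∃ δ > 0, ∀ w ∈ s, ∀ ρ, 0 < ρ →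
      ρ < δ → scaledSphericalDeriv α f w ρ < B) ⟨1, one_pos, by simp⟩ ?_ ?_ ?_
    · rintro s t hst ⟨δ, hδ, h⟩
      exact ⟨δ, hδ, fun w hw => h w (hst hw)⟩
    · rintro s t ⟨δ, hδ, h⟩ ⟨δ', hδ', h'⟩
      refine ⟨min δ δ', lt_min hδ hδ', fun w hw ρ hρ hlt => ?_⟩
      rcases hw with hw | hw
      · exact h w hw ρ hρ (hlt.trans_le (min_le_left _ _))
      · exact h' w hw ρ hρ (hlt.trans_le (min_le_right _ _))
    · intro w hw
      obtain ⟨δ, hδ, h⟩ := hsmall f hf w (hcb hw)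
      exact ⟨_, mem_nhdsWithin_of_mem_nhds h, δ, hδ, fun w hw => hw⟩
  have hstart : B ≤ scaledSphericalDeriv α f p (ε ^ 2) := by
    rw [div_lt_iff₀ (by positivity)] at hMp
    refine hMp.le.trans ?_
    unfold sphericalDeriv scaledSphericalDeriv
    rw [div_mul_eq_mul_div, mul_comm]
    gcongr
    exact pow_le_one₀ (by positivity) (pow_le_one₀ hε.le hε1)
  -- with `N = 1 / (2 ε)` and initial scale `ε ^ 2`, the total distance travelled is at most `ε`
  have hNε : 2 * (1 / (2 * ε)) * ε ^ 2 = ε := by field_simp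
  obtain ⟨z, ρ, hρ, hρε, hz, hBz, hmin⟩ := exists_almost_minimal_scale
    (P := fun w ρ => B ≤ scaledSphericalDeriv α f w ρ) (N := 1 / (2 * ε)) (by positivity) hδ
    (by positivity : 0 < ε ^ 2) hstart (by
      intro w ρ hw hρ hBw
      by_contra! hlt
      rw [hNε] at hw
      exact absurd hBw (not_le.2 (hδB w hw ρ hρ hlt)))
  rw [hNε] at hz
  refine ⟨f, hf, z, ρ, ?_, hρ, hρε.trans (by nlinarith), hBz, fun ζ hζ => ?_⟩
  · have := dist_triangle z p z₀
    linarith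
  · refine (scaledSphericalDeriv_le_half α f _ hρ).trans ?_
    gcongr
    refine (not_le.1 (hmin _ ?_ (ρ / 2) (by positivity) le_rfl)).le
    rw [mem_ball_zero_iff] at hζ
    rw [dist_eq_norm, add_sub_cancel_left, norm_mul, Complex.norm_real, Real.norm_of_nonneg hρ.le,
      mul_comm]
    gcongr

/-- **Zalcman–Pang lemma**: if the spherical derivatives of `𝓕` are unbounded near `z₀`, then some
rescalings of members of `𝓕` converge to a nonconstant entire function with bounded spherical
derivative. The hypothesis `hsmall`, that the scaled spherical derivatives of each function are
eventually below `B` as the scale tends to `0`, replaces the usual conditions on zeros. -/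
theorem exists_isZalcmanLimit {α : ℕ} {𝓕 : Set (ℂ → ℂ)} {z₀ : ℂ} {r B : ℝ} (hr : 0 < r)
    (hB : 0 < B) (hdiff : ∀ f ∈ 𝓕, DifferentiableOn ℂ f (ball z₀ r))
    (hsmall : ∀ f ∈ 𝓕, ∀ z ∈ ball z₀ r, ∃ δ > 0, ∀ᶠ w in 𝓝 z, ∀ ρ, 0 < ρ → ρ < δ →
      scaledSphericalDeriv α f w ρ < B)
    (hunb : ∀ s > 0, ∀ M : ℝ, ∃ f ∈ 𝓕, ∃ p ∈ ball z₀ s, M < sphericalDeriv f p) :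
    ∃ f z ρ g, IsZalcmanLimit α 𝓕 (ball z₀ r) f z ρ g ∧ Differentiable ℂ g ∧
      (∀ ζ, sphericalDeriv g ζ ≤ 2 ^ (α + 1) * B) ∧ B ≤ sphericalDeriv g 0 := by
  set e := min 1 (r / 2) with he
  have hepos : 0 < e := lt_min one_pos (by positivity)
  set ε : ℕ → ℝ := fun n => e * (1 / ((n : ℝ) + 1)) with hεdef
  have hεpos : ∀ n, 0 < ε n := fun n => by positivity
  have hεe : ∀ n, ε n ≤ e := fun n => by
    refine mul_le_of_le_one_right hepos.le ?_
    rw [div_le_one (by positivity)]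
    linarith [(Nat.cast_nonneg n : (0 : ℝ) ≤ n)]
  have hεlim : Tendsto ε atTop (𝓝 0) := by
    simpa only [mul_zero] using tendsto_one_div_add_atTop_nhds_zero_nat.const_mul e
  have hstep := fun n => exists_rescaling hsmall hunb (hεpos n)
    ((hεe n).trans (min_le_left _ _)) (by linarith [hεe n, min_le_right 1 (r / 2)])
  choose f hf z ρ hz hρ hρε hBz hbd using hstep
  have hρlim : Tendsto ρ atTop (𝓝 0) :=
    squeeze_zero (fun n => (hρ n).le) hρε hεlim
  have hmem : ∀ R : ℝ, ∀ᶠ n in atTop, ∀ ζ ∈ ball (0 : ℂ) R, z n + ρ n * ζ ∈ ball z₀ r := by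
    intro R
    have h1 : Tendsto (fun n => ε n * (2 + R)) atTop (𝓝 (0 * (2 + R))) := hεlim.mul_const _
    rw [zero_mul] at h1
    filter_upwards [h1.eventually (gt_mem_nhds hr)] with n hn ζ hζ
    rw [mem_ball_zero_iff] at hζ
    rw [mem_ball]
    have h2 := dist_triangle (z n + ρ n * ζ) (z n) z₀
    have h3 : dist (z n + ρ n * ζ) (z n) ≤ ε n * R := by
      rw [dist_eq_norm, add_sub_cancel_left, norm_mul, Complex.norm_real,
        Real.norm_of_nonneg (hρ n).le]
      have := hρε n
      have := hεpos n
      gcongr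
    linarith [hz n]
  set G : ℕ → ℂ → ℂ := fun n ζ => f n (z n + ρ n * ζ) / (ρ n : ℂ) ^ α with hG
  have hGd : ∀ R : ℝ, ∀ᶠ n in atTop, DifferentiableOn ℂ (G n) (ball 0 R) := by
    intro R
    filter_upwards [hmem R] with n hn
    exact ((hdiff _ (hf n)).comp (by fun_prop) hn).div_const _
  have hGs : ∀ n ζ, sphericalDeriv (G n) ζ = scaledSphericalDeriv α (f n) (z n + ρ n * ζ) (ρ n) :=
    fun n ζ => sphericalDeriv_rescale α (f n) (z n) (hρ n) ζ
  have hGB : ∀ n, B ≤ sphericalDeriv (G n) 0 := fun n => by simpa [hGs] using hBz n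
  have hGle : ∀ R : ℝ, ∀ᶠ n in atTop, ∀ ζ ∈ ball (0 : ℂ) R,
      sphericalDeriv (G n) ζ ≤ 2 ^ (α + 1) * B := by
    intro R
    have h1 : Tendsto (fun n => ε n * (2 * R)) atTop (𝓝 (0 * (2 * R))) := hεlim.mul_const _
    rw [zero_mul] at h1
    filter_upwards [h1.eventually (gt_mem_nhds one_pos)] with n hn ζ hζ
    rw [hGs]
    refine hbd n ζ (ball_subset_ball ?_ hζ)
    have := hεpos n
    rw [le_div_iff₀ (by positivity)]
    linarith
  obtain ⟨φ, hφ, ⟨g, hg⟩ | hinf⟩ := exists_subseq_of_sphericalDeriv_le isOpen_univ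
    isConnected_univ (f := G) (fun ζ _ => ⟨1, one_pos, 2 ^ (α + 1) * B, by
      have hsub : ball ζ 1 ⊆ ball 0 (‖ζ‖ + 1) := ball_subset_ball' (by simp [add_comm])
      filter_upwards [hGd (‖ζ‖ + 1), hGle (‖ζ‖ + 1)] with n h1 h2
      exact ⟨h1.mono hsub, fun w hw => h2 w (hsub hw)⟩⟩)
  · have hgd : ∀ R : ℝ, ∀ᶠ n in atTop, DifferentiableOn ℂ (G (φ n)) (ball 0 R) := fun R =>
      hφ.tendsto_atTop.eventually (hGd R)
    have hgdiff : Differentiable ℂ g := fun ζ =>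
      ((hg.mono (Set.subset_univ (ball 0 (‖ζ‖ + 1)))).differentiableOn (hgd _)
        isOpen_ball).differentiableAt (isOpen_ball.mem_nhds (by simp))
    have hlim : ∀ ζ, Tendsto (fun n => sphericalDeriv (G (φ n)) ζ) atTop
        (𝓝 (sphericalDeriv g ζ)) := by
      intro ζ
      have hmono := hg.mono (Set.subset_univ (ball 0 (‖ζ‖ + 1)))
      have hζ : ζ ∈ ball (0 : ℂ) (‖ζ‖ + 1) := by simp
      have h1 := (hmono.deriv (hgd _) isOpen_ball).tendsto_at hζ
      have h2 := hmono.tendsto_at hζ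
      exact h1.norm.div ((h2.norm.pow 2).const_add 1) (by positivity)
    refine ⟨f ∘ φ, z ∘ φ, ρ ∘ φ, g, ⟨fun n => hf _, fun n => hρ _,
      hρlim.comp hφ.tendsto_atTop, fun R => hφ.tendsto_atTop.eventually (hmem R), hg⟩, hgdiff,
      fun ζ => le_of_tendsto (hlim ζ) ?_,
      ge_of_tendsto (hlim 0) (Eventually.of_forall fun n => hGB _)⟩
    filter_upwards [hφ.tendsto_atTop.eventually (hGle (‖ζ‖ + 1))] with n hn
    exact hn ζ (by simp)
  · -- a sequence tending to `∞` has spherical derivatives tending to `0`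
    exfalso
    obtain ⟨s, hs, hC⟩ := hinf 0 (Set.mem_univ _)
    obtain ⟨n, h1, h2⟩ := ((hC (4 / (B * s))).and
      (hφ.tendsto_atTop.eventually (hGd s))).exists
    have h3 := sphericalDeriv_le_of_lt_norm hs (by positivity) h2 h1
    have h4 := hGB (φ n)
    have : 2 / (4 / (B * s) * s) = B / 2 := by field_simp; norm_num
    linarith

namespace IsZalcmanLimit

variable {α : ℕ} {𝓕 : Set (ℂ → ℂ)} {z₀ : ℂ} {r : ℝ} {f : ℕ → ℂ → ℂ} {z : ℕ → ℂ} {ρ : ℕ → ℝ}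
  {g : ℂ → ℂ}

theorem tendsto_iteratedDeriv (h : IsZalcmanLimit α 𝓕 (ball z₀ r) f z ρ g)
    (hdiff : ∀ f ∈ 𝓕, DifferentiableOn ℂ f (ball z₀ r)) (j : ℕ) :
    (∀ R : ℝ, ∀ᶠ n in atTop, DifferentiableOn ℂ (fun ζ => (ρ n : ℂ) ^ j / (ρ n : ℂ) ^ α *
      iteratedDeriv j (f n) (z n + ρ n * ζ)) (ball 0 R)) ∧
    TendstoLocallyUniformlyOn (fun n ζ => (ρ n : ℂ) ^ j / (ρ n : ℂ) ^ α *
      iteratedDeriv j (f n) (z n + ρ n * ζ)) (iteratedDeriv j g) atTop Set.univ := by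
  simp only [← iteratedDeriv_rescale]
  induction j with
  | zero =>
    simp only [iteratedDeriv_zero]
    refine ⟨fun R => ?_, h.tendsto⟩
    filter_upwards [h.eventually_mem R] with n hn
    exact ((hdiff _ (h.mem n)).comp (by fun_prop) hn).div_const _
  | succ j ih =>
    simp only [iteratedDeriv_succ]
    refine ⟨fun R => (ih.1 R).mono fun n hn => hn.deriv isOpen_ball, ?_⟩
    have hU : (Set.univ : Set ℂ) = ⋃ R : ℝ, ball (0 : ℂ) R := by
      refine (Set.eq_univ_of_forall fun ζ => Set.mem_iUnion.2 ⟨‖ζ‖ + 1, ?_⟩).symm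
      simp
    rw [hU]
    refine tendstoLocallyUniformlyOn_iUnion (fun R => isOpen_ball) fun R => ?_
    exact (ih.2.mono (Set.subset_univ _)).deriv (ih.1 R) isOpen_ball

/-- Hurwitz's theorem for the `j`-th derivatives of the rescalings. -/
theorem eventually_exists_iteratedDeriv_eq (h : IsZalcmanLimit α 𝓕 (ball z₀ r) f z ρ g)
    (hdiff : ∀ f ∈ 𝓕, DifferentiableOn ℂ f (ball z₀ r)) (hg : Differentiable ℂ g) (j : ℕ) {ζ₀ : ℂ}
    (hne : ∃ ζ, iteratedDeriv j g ζ ≠ iteratedDeriv j g ζ₀) {c : ℕ → ℂ}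
    (hc : Tendsto c atTop (𝓝 (iteratedDeriv j g ζ₀))) {ε : ℝ} (hε : 0 < ε) :
    ∀ᶠ n in atTop, ∃ ζ ∈ ball ζ₀ ε, z n + ρ n * ζ ∈ ball z₀ r ∧
      (ρ n : ℂ) ^ j / (ρ n : ℂ) ^ α * iteratedDeriv j (f n) (z n + ρ n * ζ) = c n := by
  obtain ⟨hd, hlim⟩ := h.tendsto_iteratedDeriv hdiff j
  have hsub : ∀ s : ℝ, ball ζ₀ s ⊆ ball 0 (‖ζ₀‖ + s) := fun s =>
    ball_subset_ball' (by simp [add_comm])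
  have hgj : Differentiable ℂ (iteratedDeriv j g) :=
    (hg.contDiff (n := ⊤)).differentiable_iteratedDeriv j (by exact_mod_cast WithTop.coe_lt_top _)
  have hne' : ¬ ∀ᶠ ζ in 𝓝 ζ₀, iteratedDeriv j g ζ = iteratedDeriv j g ζ₀ := by
    intro hev
    obtain ⟨ζ, hζ⟩ := hne
    exact hζ (congrFun (AnalyticOnNhd.eq_of_eventuallyEq (fun w _ => hgj.analyticAt w)
      (fun w _ => analyticAt_const) hev) ζ)
  filter_upwards [eventually_exists_mem_ball_eq one_pos ((hd (‖ζ₀‖ + 1)).mono fun n hn =>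
      hn.mono (hsub 1)) (hlim.mono (Set.subset_univ _)) hne' hc hε, h.eventually_mem (‖ζ₀‖ + ε)]
    with n h1 h2
  obtain ⟨ζ, hζ, hζc⟩ := h1
  exact ⟨ζ, hζ, h2 ζ (hsub ε hζ), hζc⟩

theorem iteratedDeriv_eq_of_eventually (h : IsZalcmanLimit α 𝓕 (ball z₀ r) f z ρ g)
    (hdiff : ∀ f ∈ 𝓕, DifferentiableOn ℂ f (ball z₀ r)) (hg : Differentiable ℂ g) (j : ℕ) {ζ₀ d : ℂ}
    {c : ℕ → ℂ} (hc : Tendsto c atTop (𝓝 d))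
    (hex : ∀ ε > 0, ∀ᶠ n in atTop, ∃ ζ ∈ ball ζ₀ ε,
      (ρ n : ℂ) ^ j / (ρ n : ℂ) ^ α * iteratedDeriv j (f n) (z n + ρ n * ζ) = c n) :
    iteratedDeriv j g ζ₀ = d :=
  eq_of_eventually_exists_mem_ball_eq (h.tendsto_iteratedDeriv hdiff j).2
    ((hg.contDiff (n := ⊤)).differentiable_iteratedDeriv j
      (by exact_mod_cast WithTop.coe_lt_top _)).continuous.continuousAt hc hex

end IsZalcmanLimit

/-! ### Entire functions of exponential type and polynomials -/

theorem exists_norm_iteratedDeriv_le_exp {g : ℂ → ℂ} (hg : Differentiable ℂ g) {A : ℝ}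
    (hA : 0 ≤ A) (h : ∀ z, ‖g z‖ ≤ Real.exp (A * (1 + ‖z‖))) (k : ℕ) :
    ∃ A' : ℝ, 0 ≤ A' ∧ ∀ z, ‖iteratedDeriv k g z‖ ≤ Real.exp (A' * (1 + ‖z‖)) := by
  refine ⟨k.factorial + 2 * A, by positivity, fun z => ?_⟩
  have h1 := Complex.norm_iteratedDeriv_le_of_forall_mem_sphere_norm_le (n := k) (c := z) (R := 1)
    (C := Real.exp (2 * A * (1 + ‖z‖))) (f := g) one_pos hg.diffContOnCl (fun w hw => by
      refine (h w).trans (Real.exp_le_exp.2 ?_)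
      have h2 : ‖w‖ ≤ 1 + ‖z‖ := by
        have := norm_le_norm_add_norm_sub' w z
        rw [mem_sphere, dist_eq_norm] at hw
        linarith
      nlinarith [norm_nonneg z])
  refine h1.trans ?_
  rw [one_pow, div_one]
  have h3 : (k.factorial : ℝ) ≤ Real.exp k.factorial := by
    linarith [Real.add_one_le_exp (k.factorial : ℝ)]
  calc (k.factorial : ℝ) * Real.exp (2 * A * (1 + ‖z‖))
      ≤ Real.exp k.factorial * Real.exp (2 * A * (1 + ‖z‖)) := by gcongr
    _ = Real.exp (k.factorial + 2 * A * (1 + ‖z‖)) := (Real.exp_add _ _).symm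
    _ ≤ _ := Real.exp_le_exp.2 (by
        nlinarith [norm_nonneg z, (Nat.cast_nonneg k.factorial : (0 : ℝ) ≤ k.factorial)])

/-- A zero-free entire function of exponential type is `exp` of a polynomial of degree at most `1`. -/
theorem exists_eq_exp_linear {h : ℂ → ℂ} (hh : Differentiable ℂ h) (h0 : ∀ z, h z ≠ 0) {A : ℝ}
    (hA : 0 ≤ A) (hle : ∀ z, ‖h z‖ ≤ Real.exp (A * (1 + ‖z‖))) :
    ∃ α β : ℂ, ∀ z, h z = Complex.exp (α * z + β) := by
  have hd : Differentiable ℂ (fun z => deriv h z / h z) :=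
    (hh.contDiff (n := 2)).differentiable_deriv_two.div hh h0
  obtain ⟨H, hH, hexp⟩ := exists_exp_eq_of_isExactOn isOpen_univ isPreconnected_univ
    hh.differentiableOn (fun w _ => h0 w) hd.isExactOn_univ (Set.mem_univ 0)
  have hHd : Differentiable ℂ H := differentiableOn_univ.1 hH
  have hre : ∀ z, (H z).re ≤ A * (1 + ‖z‖) := by
    intro z
    have := hle z
    rw [← hexp z (Set.mem_univ z), Complex.norm_exp] at this
    exact Real.exp_le_exp.1 this
  set K := 6 * A + 2 + 3 * ‖H 0‖ with hK
  have hHle : ∀ z, ‖H z‖ ≤ K * (1 + ‖z‖) := by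
    intro z
    have hz := norm_nonneg z
    have h1 := Complex.borelCaratheodory (M := A * (1 + 2 * (1 + ‖z‖)) + 1) (R := 2 * (1 + ‖z‖))
      (z := z) (f := H) (by positivity) hHd.differentiableOn (fun w hw => by
        rw [mem_ball_zero_iff] at hw
        have := hre w
        have : A * (1 + ‖w‖) ≤ A * (1 + 2 * (1 + ‖z‖)) := by gcongr
        simp only [Set.mem_ofPred_eq]
        linarith) (by positivity) (by rw [mem_ball_zero_iff]; linarith)
    have hden : 1 + ‖z‖ ≤ 2 * (1 + ‖z‖) - ‖z‖ := by linarith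
    have h2 : 2 * (A * (1 + 2 * (1 + ‖z‖)) + 1) * ‖z‖ / (2 * (1 + ‖z‖) - ‖z‖) ≤
        2 * (A * (1 + 2 * (1 + ‖z‖)) + 1) := by
      rw [div_le_iff₀ (by linarith)]
      gcongr
      linarith
    have h3 : ‖H 0‖ * (2 * (1 + ‖z‖) + ‖z‖) / (2 * (1 + ‖z‖) - ‖z‖) ≤ ‖H 0‖ * 3 := by
      rw [div_le_iff₀ (by linarith), mul_assoc]
      gcongr
      linarith
    have := norm_nonneg (H 0)
    rw [hK]
    nlinarith [mul_nonneg hA hz, mul_nonneg this hz]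
  have hder : ∀ z, ‖deriv H z‖ ≤ 2 * K := by
    intro z
    have hz := norm_nonneg z
    have h1 := Complex.norm_deriv_le_of_forall_mem_sphere_norm_le (c := z) (R := 1 + ‖z‖)
      (C := K * (2 * (1 + ‖z‖))) (f := H) (by positivity) hHd.diffContOnCl (fun w hw => by
        refine (hHle w).trans ?_
        have h2 : ‖w‖ ≤ 1 + 2 * ‖z‖ := by
          have := norm_le_norm_add_norm_sub' w z
          rw [mem_sphere, dist_eq_norm] at hw
          linarith
        have : 0 ≤ K := by positivity
        gcongr
        linarith)
    refine h1.trans (le_of_eq ?_)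
    field_simp
  obtain ⟨α, hα⟩ := ((hHd.contDiff (n := 2)).differentiable_deriv_two).exists_const_forall_eq_of_bounded
    (isBounded_iff_forall_norm_le.2 ⟨2 * K, by rintro _ ⟨z, rfl⟩; exact hder z⟩)
  refine ⟨α, H 0, fun z => ?_⟩
  have hlin : ∀ w, HasDerivAt (fun z => H z - α * z) 0 w := fun w => by
    refine ((hHd w).hasDerivAt.sub ((hasDerivAt_id w).const_mul α)).congr_deriv ?_
    simp [hα w]
  have := is_const_of_deriv_eq_zero (fun w => (hlin w).differentiableAt) (fun w => (hlin w).deriv) z 0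
  simp only [mul_zero, sub_zero] at this
  rw [← hexp z (Set.mem_univ z), ← this]
  ring_nf

theorem exists_eq_const_add_exp {h : ℂ → ℂ} (hh : Differentiable ℂ h) {A : ℝ}
    (hA : 0 ≤ A) (hle : ∀ z, ‖h z‖ ≤ Real.exp (A * (1 + ‖z‖))) {b : ℂ} (hb : ∀ z, h z ≠ b) :
    ∃ α β : ℂ, ∀ z, h z = b + Complex.exp (α * z + β) := by
  obtain ⟨α, β, hαβ⟩ := exists_eq_exp_linear (hh.sub_const b) (fun z => sub_ne_zero.2 (hb z))
    (A := A + ‖b‖) (by positivity) (fun z => by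
      have h1 : 1 ≤ Real.exp (A * (1 + ‖z‖)) := Real.one_le_exp (by positivity)
      have h2 : 1 + ‖b‖ ≤ Real.exp (‖b‖ * (1 + ‖z‖)) := by
        have := Real.add_one_le_exp (‖b‖ * (1 + ‖z‖))
        nlinarith [mul_nonneg (norm_nonneg b) (norm_nonneg z)]
      rw [add_mul, Real.exp_add]
      calc ‖h z - b‖ ≤ ‖h z‖ + ‖b‖ := norm_sub_le _ _
        _ ≤ Real.exp (A * (1 + ‖z‖)) * (1 + ‖b‖) := by nlinarith [hle z, norm_nonneg b]
        _ ≤ _ := by gcongr)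
  exact ⟨α, β, fun z => by rw [← hαβ z]; ring⟩

theorem iteratedDeriv_eq_zero_of_lt {g : ℂ → ℂ} {k : ℕ} {c : ℂ}
    (h : ∀ z, iteratedDeriv k g z = c) {n : ℕ} (hn : k < n) (z : ℂ) : iteratedDeriv n g z = 0 := by
  obtain ⟨m, rfl⟩ := Nat.exists_eq_add_of_lt hn
  induction m generalizing z with
  | zero => rw [add_zero, iteratedDeriv_succ, funext h, deriv_const]
  | succ m ih =>
    rw [iteratedDeriv_succ, show iteratedDeriv (k + (m + 1)) g = fun _ => 0 from
      funext fun w => ih w (by omega), deriv_const]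

theorem exists_polynomial_of_iteratedDeriv_eq {g : ℂ → ℂ} (hg : Differentiable ℂ g) {k : ℕ} {c : ℂ}
    (h : ∀ z, iteratedDeriv k g z = c) : ∃ P : Polynomial ℂ, ∀ z, g z = P.eval z := by
  refine ⟨∑ n ∈ Finset.range (k + 1),
    Polynomial.C ((n.factorial : ℂ)⁻¹ * iteratedDeriv n g 0) * Polynomial.X ^ n, fun z => ?_⟩
  rw [← Complex.taylorSeries_eq_of_entire' 0 z hg, tsum_eq_sum (s := Finset.range (k + 1))]
  · simp [Polynomial.eval_finsetSum]
  · intro n hn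
    rw [iteratedDeriv_eq_zero_of_lt h (by simpa using hn)]
    simp

theorem eq_zero_of_iteratedDeriv_eq_zero {g : ℂ → ℂ} (hg : Differentiable ℂ g) {k : ℕ}
    (h : ∀ z, iteratedDeriv k g z = 0) {z₁ : ℂ} (h1 : ∀ j < k, iteratedDeriv j g z₁ = 0) (z : ℂ) :
    g z = 0 := by
  rw [← Complex.taylorSeries_eq_of_entire' z₁ z hg]
  refine (tsum_congr fun n => ?_).trans tsum_zero
  have : iteratedDeriv n g z₁ = 0 := by
    rcases lt_trichotomy n k with hn | rfl | hn
    · exact h1 n hn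
    · exact h z₁
    · exact iteratedDeriv_eq_zero_of_lt h hn z₁
  simp [this]

/-- A nonconstant entire function with constant `k`-th derivative is a nonconstant polynomial, so it
has a zero. -/
theorem exists_eq_zero_of_iteratedDeriv_eq {g : ℂ → ℂ} (hg : Differentiable ℂ g) {k : ℕ} {c : ℂ}
    (h : ∀ z, iteratedDeriv k g z = c) (hne : ∀ d, ∃ z, g z ≠ d) : ∃ z₁, g z₁ = 0 := by
  obtain ⟨P, hP⟩ := exists_polynomial_of_iteratedDeriv_eq hg h
  have hdeg : 0 < P.degree := by
    by_contra! hcon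
    rw [Polynomial.eq_C_of_degree_le_zero hcon] at hP
    obtain ⟨z, hz⟩ := hne (P.coeff 0)
    exact hz (by simpa using hP z)
  obtain ⟨z₁, hz₁⟩ := Complex.exists_root hdeg
  exact ⟨z₁, by rw [hP]; exact hz₁⟩

theorem iteratedDeriv_cexp_linear (j : ℕ) (α β z : ℂ) :
    iteratedDeriv j (fun z => Complex.exp (α * z + β)) z = α ^ j * Complex.exp (α * z + β) := by
  induction j generalizing z with
  | zero => simp
  | succ j ih =>
    rw [iteratedDeriv_succ, funext ih, deriv_const_mul_field]
    have : HasDerivAt (fun z => Complex.exp (α * z + β)) (Complex.exp (α * z + β) * (α * 1)) z :=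
      (((hasDerivAt_id z).const_mul α).add_const β).cexp
    rw [this.deriv]
    ring

/-- If `g⁽ᵏ⁾ = b + exp (α z + β)` with `α ≠ 0`, then `g⁽ᵏ⁾ = a` at infinitely many points, and there
`g` agrees with a polynomial whose `k`-th derivative is `b ≠ 0`; so `g` cannot vanish at all of
them. -/
theorem exists_iteratedDeriv_eq_ne_zero {g : ℂ → ℂ} (hg : Differentiable ℂ g) {k : ℕ} (hk : 1 ≤ k)
    {a b α β : ℂ} (hα : α ≠ 0) (hab : a ≠ b) (hb : b ≠ 0)
    (h : ∀ z, iteratedDeriv k g z = b + Complex.exp (α * z + β)) :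
    ∃ z, iteratedDeriv k g z = a ∧ g z ≠ 0 := by
  by_contra! hcon
  set Φ : ℂ → ℂ := fun z => (α ^ k)⁻¹ * Complex.exp (α * z + β) with hΦ
  have hΦd : Differentiable ℂ Φ := by fun_prop
  have hu : ∀ z, iteratedDeriv k (g - Φ) z = b := by
    intro z
    rw [iteratedDeriv_sub hg.contDiff.contDiffAt hΦd.contDiff.contDiffAt, h, hΦ,
      iteratedDeriv_const_mul_field, iteratedDeriv_cexp_linear, ← mul_assoc,
      inv_mul_cancel₀ (pow_ne_zero k hα), one_mul, add_sub_cancel_right]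
  obtain ⟨P, hP⟩ := exists_polynomial_of_iteratedDeriv_eq (hg.sub hΦd) hu
  set d : ℂ := -((α ^ k)⁻¹ * (a - b)) with hd
  set x : ℤ → ℂ := fun m => (Complex.log (a - b) + m * (2 * Real.pi * Complex.I) - β) / α with hx
  have hxinj : Function.Injective x := by
    intro m m' hmm
    simp only [hx] at hmm
    rw [div_left_inj' hα] at hmm
    have h2 : (m : ℂ) * (2 * Real.pi * Complex.I) = m' * (2 * Real.pi * Complex.I) := by
      linear_combination hmm
    exact_mod_cast mul_right_cancel₀ Complex.two_pi_I_ne_zero h2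
  have hxe : ∀ m, Complex.exp (α * x m + β) = a - b := by
    intro m
    have : α * x m + β = Complex.log (a - b) + m * (2 * Real.pi * Complex.I) := by
      simp only [hx]; field_simp; ring
    rw [this, Complex.exp_add, Complex.exp_log (sub_ne_zero.2 hab), Complex.exp_int_mul_two_pi_mul_I,
      mul_one]
  have hroot : ∀ m, (P - Polynomial.C d).eval (x m) = 0 := by
    intro m
    have h1 : g (x m) = 0 := hcon _ (by rw [h, hxe]; ring)
    rw [Polynomial.eval_sub, Polynomial.eval_C, ← hP, Pi.sub_apply, h1]
    simp only [hΦ, hxe, hd]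
    ring
  have hPC : P - Polynomial.C d = 0 := Polynomial.eq_zero_of_infinite_isRoot _
    ((Set.infinite_range_of_injective hxinj).mono (by rintro _ ⟨m, rfl⟩; exact hroot m))
  have hconst : g - Φ = fun _ => d := by
    funext z
    rw [hP, sub_eq_zero.1 hPC, Polynomial.eval_C]
  refine hb ?_
  rw [← hu 0, hconst, iteratedDeriv_const, if_neg (by omega)]

/-! ### Scaled spherical derivatives at small scales -/

theorem eventually_scaledSphericalDeriv_lt_of_le {α : ℕ} {f : ℂ → ℂ} {z : ℂ} {B m : ℝ} (hB : 0 < B)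
    (hf : AnalyticAt ℂ f z) (hm : 0 < m)
    (h : ∀ᶠ w in 𝓝 z, ∀ ρ : ℝ, 0 < ρ → m ≤ ρ ^ (2 * α) + ‖f w‖ ^ 2) :
    ∃ δ > 0, ∀ᶠ w in 𝓝 z, ∀ ρ, 0 < ρ → ρ < δ → scaledSphericalDeriv α f w ρ < B := by
  set C := ‖deriv f z‖ + 1 with hC
  have hCpos : 0 < C := by positivity
  refine ⟨min 1 (B * m / C), lt_min one_pos (by positivity), ?_⟩
  filter_upwards [h, hf.deriv.continuousAt.norm.eventually (gt_mem_nhds (lt_add_one _))]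
    with w hw hwC ρ hρ hρδ
  have h1 : ρ ^ (α + 1) ≤ ρ := by
    rw [pow_succ]
    exact mul_le_of_le_one_left hρ.le (pow_le_one₀ hρ.le (hρδ.le.trans (min_le_left _ _)))
  have h2 : ρ * C < B * m := (lt_div_iff₀ hCpos).1 (hρδ.trans_le (min_le_right _ _))
  unfold scaledSphericalDeriv
  calc ρ ^ (α + 1) * ‖deriv f w‖ / (ρ ^ (2 * α) + ‖f w‖ ^ 2) ≤ ρ * C / m := by
        gcongr
        exact hw ρ hρ
    _ < B := by rwa [div_lt_iff₀ hm]

theorem eventually_scaledSphericalDeriv_zero_lt {f : ℂ → ℂ} {z : ℂ} {B : ℝ} (hB : 0 < B)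
    (hf : AnalyticAt ℂ f z) :
    ∃ δ > 0, ∀ᶠ w in 𝓝 z, ∀ ρ, 0 < ρ → ρ < δ → scaledSphericalDeriv 0 f w ρ < B :=
  eventually_scaledSphericalDeriv_lt_of_le hB hf one_pos (Eventually.of_forall fun w ρ _ => by
    simp)

theorem eventually_scaledSphericalDeriv_lt_of_ne_zero {α : ℕ} {f : ℂ → ℂ} {z : ℂ} {B : ℝ}
    (hB : 0 < B) (hf : AnalyticAt ℂ f z) (h0 : f z ≠ 0) :
    ∃ δ > 0, ∀ᶠ w in 𝓝 z, ∀ ρ, 0 < ρ → ρ < δ → scaledSphericalDeriv α f w ρ < B := by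
  have hpos : 0 < ‖f z‖ := norm_pos_iff.2 h0
  refine eventually_scaledSphericalDeriv_lt_of_le hB hf (m := (‖f z‖ / 2) ^ 2) (by positivity) ?_
  filter_upwards [hf.continuousAt.norm.eventually (lt_mem_nhds (half_lt_self hpos))] with w hw ρ hρ
  have : (‖f z‖ / 2) ^ 2 ≤ ‖f w‖ ^ 2 := by gcongr
  have : 0 < ρ ^ (2 * α) := by positivity
  linarith

theorem eventually_scaledSphericalDeriv_one_lt {f : ℂ → ℂ} {z : ℂ} {B : ℝ}
    (hf : AnalyticAt ℂ f z) (h : ‖deriv f z‖ < B) :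
    ∃ δ > 0, ∀ᶠ w in 𝓝 z, ∀ ρ, 0 < ρ → ρ < δ → scaledSphericalDeriv 1 f w ρ < B := by
  refine ⟨1, one_pos, ?_⟩
  filter_upwards [hf.deriv.continuousAt.norm.eventually (gt_mem_nhds h)] with w hw ρ hρ _
  refine lt_of_le_of_lt ?_ hw
  unfold scaledSphericalDeriv
  rw [div_le_iff₀ (by positivity), mul_comm]
  gcongr
  simp only [Nat.reduceAdd, mul_one]
  linarith [sq_nonneg ‖f w‖]

/-- Near a zero of order greater than `α`, the scaled spherical derivatives tend to `0` with the
scale. With `s` the distance to the zero, points with `s ≥ T ρ` and with `s < T ρ` are treated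
separately, for a constant `T`. -/
theorem eventually_scaledSphericalDeriv_lt_of_lt_order {α : ℕ} {f : ℂ → ℂ} {z : ℂ} {B : ℝ}
    (hB : 0 < B) (hf : AnalyticAt ℂ f z) (h : ((α + 1 : ℕ) : ℕ∞) ≤ analyticOrderAt f z) :
    ∃ δ > 0, ∀ᶠ w in 𝓝 z, ∀ ρ, 0 < ρ → ρ < δ → scaledSphericalDeriv α f w ρ < B := by
  by_cases htop : analyticOrderAt f z = ⊤
  · rw [analyticOrderAt_eq_top] at htop
    refine ⟨1, one_pos, ?_⟩
    filter_upwards [htop.eventually_nhds] with w hw ρ hρ _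
    have : deriv f w = 0 := by
      rw [EventuallyEq.deriv_eq (f := fun _ => (0 : ℂ)) hw, deriv_const]
    simpa [scaledSphericalDeriv, this] using hB
  obtain ⟨m, hm⟩ := ENat.ne_top_iff_exists.1 htop
  rw [← hm, Nat.cast_le] at h
  obtain ⟨n, rfl⟩ : ∃ n, m = n + 1 := ⟨m - 1, by omega⟩
  have hn : α ≤ n := by omega
  obtain ⟨v, hv, hv0, hfv⟩ := hf.analyticOrderAt_eq_natCast.1 hm.symm
  have hdo : (n : ℕ∞) ≤ analyticOrderAt (deriv f) z := by
    rw [natCast_le_analyticOrderAt_iff_iteratedDeriv_eq_zero hf.deriv]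
    intro i hi
    rw [← iteratedDeriv_succ']
    exact (natCast_le_analyticOrderAt_iff_iteratedDeriv_eq_zero hf).1 hm.le (i + 1) (by omega)
  obtain ⟨y, hy, hdy⟩ := (natCast_le_analyticOrderAt hf.deriv).1 hdo
  set c := ‖v z‖ / 2 with hc
  have hvpos : 0 < ‖v z‖ := norm_pos_iff.2 hv0
  have hcpos : 0 < c := by positivity
  set C := ‖y z‖ + 1 with hC
  have hCpos : 0 < C := by positivity
  set T := C / (c * B) with hT
  have hTpos : 0 < T := by positivity
  refine ⟨B / (C * T ^ α), by positivity, ?_⟩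
  filter_upwards [hfv, hdy, hv.continuousAt.norm.eventually (lt_mem_nhds (half_lt_self hvpos)),
    hy.continuousAt.norm.eventually (gt_mem_nhds (lt_add_one _)), ball_mem_nhds z one_pos]
    with w hfw hdw hvw hyw hwz ρ hρ hρδ
  set s := ‖w - z‖ with hs
  have hs1 : s ≤ 1 := by rw [mem_ball, dist_eq_norm] at hwz; exact hwz.le
  have hs0 : 0 ≤ s := norm_nonneg _
  have hflow : c * s ^ (n + 1) ≤ ‖f w‖ := by
    rw [hfw, smul_eq_mul, norm_mul, norm_pow, mul_comm]
    gcongr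
  have hdup : ‖deriv f w‖ ≤ C * s ^ n := by
    rw [hdw, smul_eq_mul, norm_mul, norm_pow, mul_comm]
    gcongr
  unfold scaledSphericalDeriv
  rw [div_lt_iff₀ (by positivity)]
  rcases le_or_gt (T * ρ) s with hcase | hcase
  · -- far from the zero, the denominator is at least `2 ρ ^ α ‖f w‖`
    have hspos : 0 < s := (by positivity : 0 < T * ρ).trans_le hcase
    have h1 : 2 * (ρ ^ α * ‖f w‖) ≤ ρ ^ (2 * α) + ‖f w‖ ^ 2 := by
      rw [pow_mul']
      nlinarith [sq_nonneg (ρ ^ α - ‖f w‖)]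
    have h2 : C * ρ ≤ B * (c * s) := by
      have : T * ρ * (c * B) = C * ρ := by rw [hT]; field_simp
      rw [← this]
      have : T * ρ * (c * B) ≤ s * (c * B) := by gcongr
      linarith
    have h3 : 0 < B * (ρ ^ α * (c * s ^ (n + 1))) := by positivity
    calc ρ ^ (α + 1) * ‖deriv f w‖ ≤ ρ ^ (α + 1) * (C * s ^ n) := by gcongr
      _ = (C * ρ) * (ρ ^ α * s ^ n) := by ring
      _ ≤ B * (c * s) * (ρ ^ α * s ^ n) := by gcongr
      _ = B * (ρ ^ α * (c * s ^ (n + 1))) := by ring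
      _ < B * (2 * (ρ ^ α * (c * s ^ (n + 1)))) := by linarith
      _ ≤ B * (2 * (ρ ^ α * ‖f w‖)) := by gcongr
      _ ≤ _ := by gcongr
  · -- close to the zero, the numerator is small
    have h1 : ρ * (C * T ^ α) < B := (lt_div_iff₀ (by positivity)).1 hρδ
    have h2 : s ^ n ≤ (T * ρ) ^ α := (pow_le_pow_of_le_one hs0 hs1 hn).trans (by gcongr)
    calc ρ ^ (α + 1) * ‖deriv f w‖ ≤ ρ ^ (α + 1) * (C * (T * ρ) ^ α) := by
          gcongr
          exact hdup.trans (by gcongr)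
      _ = ρ * (C * T ^ α) * ρ ^ (2 * α) := by rw [mul_pow]; ring
      _ < B * ρ ^ (2 * α) := by gcongr
      _ ≤ _ := by gcongr; linarith [sq_nonneg ‖f w‖]

/-! ### Local bounds for the spherical derivatives of the family -/

theorem exists_ne_of_sphericalDeriv_pos {g : ℂ → ℂ} {ζ : ℂ} (h : 0 < sphericalDeriv g ζ) (d : ℂ) :
    ∃ z, g z ≠ d := by
  by_contra! hcon
  rw [show g = fun _ => d from funext hcon] at h
  simp [sphericalDeriv] at h

namespace IsZalcmanLimit

variable {α : ℕ} {𝓕 : Set (ℂ → ℂ)} {z₀ : ℂ} {r : ℝ} {f : ℕ → ℂ → ℂ} {z : ℕ → ℂ} {ρ : ℕ → ℝ}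
  {g : ℂ → ℂ}

/-- An implication between values of the `i`-th and the `j`-th derivatives of the rescalings passes to
the limit function, unless its `i`-th derivative is constant. -/
theorem iteratedDeriv_eq_of_imp (h : IsZalcmanLimit α 𝓕 (ball z₀ r) f z ρ g)
    (hdiff : ∀ f ∈ 𝓕, DifferentiableOn ℂ f (ball z₀ r)) (hg : Differentiable ℂ g) (i j : ℕ)
    {ζ₀ e : ℂ} {c d : ℕ → ℂ} (hne : ∃ ζ, iteratedDeriv i g ζ ≠ iteratedDeriv i g ζ₀)
    (hc : Tendsto c atTop (𝓝 (iteratedDeriv i g ζ₀))) (hd : Tendsto d atTop (𝓝 e))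
    (himp : ∀ n, ∀ w ∈ ball z₀ r,
      (ρ n : ℂ) ^ i / (ρ n : ℂ) ^ α * iteratedDeriv i (f n) w = c n →
      (ρ n : ℂ) ^ j / (ρ n : ℂ) ^ α * iteratedDeriv j (f n) w = d n) :
    iteratedDeriv j g ζ₀ = e := by
  refine h.iteratedDeriv_eq_of_eventually hdiff hg j hd fun ε hε => ?_
  filter_upwards [h.eventually_exists_iteratedDeriv_eq hdiff hg i hne hc hε] with n hn
  obtain ⟨ζ, hζ, hmem, hζc⟩ := hn
  exact ⟨ζ, hζ, himp n _ hmem hζc⟩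

theorem ofReal_ne_zero (h : IsZalcmanLimit α 𝓕 (ball z₀ r) f z ρ g) (n : ℕ) : (ρ n : ℂ) ≠ 0 :=
  Complex.ofReal_ne_zero.2 (h.pos n).ne'

theorem tendsto_ofReal_pow (h : IsZalcmanLimit α 𝓕 (ball z₀ r) f z ρ g) {k : ℕ} (hk : 1 ≤ k) :
    Tendsto (fun n => (ρ n : ℂ) ^ k) atTop (𝓝 0) := by
  have h1 : Tendsto (fun n => (ρ n : ℂ)) atTop (𝓝 0) := by
    have := (Complex.continuous_ofReal.tendsto 0).comp h.tendsto_zero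
    simpa only [Complex.ofReal_zero] using! this
  have := h1.pow k
  rwa [zero_pow (by omega)] at this

theorem iteratedDeriv_eq_zero_of_multiplicity (h : IsZalcmanLimit α 𝓕 (ball z₀ r) f z ρ g)
    (hdiff : ∀ f ∈ 𝓕, DifferentiableOn ℂ f (ball z₀ r)) (hg : Differentiable ℂ g) {k : ℕ}
    (hmult : ∀ f ∈ 𝓕, ZerosMultiplicityGeOn f k (ball z₀ r)) (hne : ∃ ζ, g ζ ≠ 0) {ζ₀ : ℂ}
    (h0 : g ζ₀ = 0) {j : ℕ} (hj : j < k) : iteratedDeriv j g ζ₀ = 0 := by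
  refine h.iteratedDeriv_eq_of_imp hdiff hg 0 j (c := fun _ => 0) (d := fun _ => 0)
    (by simpa [h0] using hne) (by simp [h0]) tendsto_const_nhds fun n w hw hfw => ?_
  have hρ := h.ofReal_ne_zero n
  have hfw0 : f n w = 0 := by simpa [hρ] using hfw
  have ha := (hdiff _ (h.mem n)).analyticAt (isOpen_ball.mem_nhds hw)
  rw [(natCast_le_analyticOrderAt_iff_iteratedDeriv_eq_zero ha).1
    (hmult _ (h.mem n) w hw hfw0) j hj, mul_zero]

end IsZalcmanLimit

/-- The case `k ≥ 2`, `a ≠ 0`, by rescaling without weight. For the limit function `g`, the relations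
`f = a → f⁽ᵏ⁾ = a` and `f⁽ᵏ⁾ = b → f = b` become `g = a → g⁽ᵏ⁾ = 0` and `g⁽ᵏ⁾ = 0 → g = b`. So `g`
omits `a`, and `g = a + exp (α ζ + β)` has a simple zero. -/
theorem exists_sphericalDeriv_le_of_two_le {𝓕 : Set (ℂ → ℂ)} {z₀ : ℂ} {r : ℝ} (hr : 0 < r)
    {k : ℕ} (hk : 2 ≤ k) {a b : ℂ} (ha : a ≠ 0) (hab : a ≠ b)
    (hdiff : ∀ f ∈ 𝓕, DifferentiableOn ℂ f (ball z₀ r))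
    (hmult : ∀ f ∈ 𝓕, ZerosMultiplicityGeOn f k (ball z₀ r))
    (hshare : ∀ f ∈ 𝓕, ∀ z ∈ ball z₀ r, f z = a → iteratedDeriv k f z = a)
    (hval : ∀ f ∈ 𝓕, ∀ z ∈ ball z₀ r, iteratedDeriv k f z = b → f z = b) :
    ∃ s > 0, ∃ M : ℝ, ∀ f ∈ 𝓕, ∀ p ∈ ball z₀ s, sphericalDeriv f p ≤ M := by
  by_contra! hunb
  obtain ⟨f, z, ρ, g, h, hg, hgM, hg0⟩ := exists_isZalcmanLimit (α := 0) hr one_pos hdiff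
    (fun f hf z hz => eventually_scaledSphericalDeriv_zero_lt one_pos
      ((hdiff f hf).analyticAt (isOpen_ball.mem_nhds hz))) hunb
  have hne := exists_ne_of_sphericalDeriv_pos (one_pos.trans_le hg0)
  have hzero : ∀ ζ, g ζ = 0 → ∀ j < k, iteratedDeriv j g ζ = 0 := fun ζ hζ j hj =>
    h.iteratedDeriv_eq_zero_of_multiplicity hdiff hg hmult (hne 0) hζ hj
  have hk0 : ∃ ζ, iteratedDeriv k g ζ ≠ 0 := by
    by_contra! hcon
    obtain ⟨z₁, hz₁⟩ := exists_eq_zero_of_iteratedDeriv_eq hg hcon hne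
    obtain ⟨ζ, hζ⟩ := hne 0
    exact hζ (eq_zero_of_iteratedDeriv_eq_zero hg hcon (hzero z₁ hz₁) ζ)
  have hga : ∀ ζ, g ζ ≠ a := by
    intro ζ hζ
    have hlim : ∀ c : ℂ, Tendsto (fun n => (ρ n : ℂ) ^ k * c) atTop (𝓝 0) := fun c => by
      simpa using (h.tendsto_ofReal_pow (by omega : 1 ≤ k)).mul_const c
    have h1 : iteratedDeriv k g ζ = 0 := by
      refine h.iteratedDeriv_eq_of_imp hdiff hg 0 k (c := fun _ => a) (by simpa [hζ] using hne a)
        (by simp [hζ]) (hlim a) fun n w hw hfw => ?_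
      rw [hshare _ (h.mem n) w hw (by simpa using hfw), pow_zero, div_one]
    have h2 : iteratedDeriv 0 g ζ = b := by
      refine h.iteratedDeriv_eq_of_imp hdiff hg k 0 (c := fun n => (ρ n : ℂ) ^ k * b)
        (d := fun _ => b) (by simpa [h1] using hk0) (by rw [h1]; exact hlim b) tendsto_const_nhds
        fun n w hw hfw => ?_
      rw [pow_zero, div_one] at hfw
      have := hval _ (h.mem n) w hw (mul_left_cancel₀ (pow_ne_zero k (h.ofReal_ne_zero n)) hfw)
      simpa using this
    exact hab (hζ.symm.trans (by simpa using h2))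
  obtain ⟨A, hA, hgA⟩ := exists_norm_le_exp_of_sphericalDeriv_le hg hgM
  obtain ⟨α, β, hαβ⟩ := exists_eq_const_add_exp hg hA hgA hga
  have hα : α ≠ 0 := by
    rintro rfl
    obtain ⟨ζ, hζ⟩ := hne (a + Complex.exp β)
    exact hζ (by simpa using hαβ ζ)
  set ζ₁ := (Complex.log (-a) - β) / α with hζ₁
  have hexp : Complex.exp (α * ζ₁ + β) = -a := by
    rw [hζ₁, mul_div_cancel₀ _ hα, sub_add_cancel, Complex.exp_log (neg_ne_zero.2 ha)]
  have h1 := hzero ζ₁ (by rw [hαβ, hexp, add_neg_cancel]) 1 (by omega)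
  rw [show g = fun ζ => a + Complex.exp (α * ζ + β) from funext hαβ,
    iteratedDeriv_const_add one_pos, iteratedDeriv_cexp_linear, hexp] at h1
  simp [hα, ha] at h1

/-- The case of functions whose zeros are the points with `f⁽ᵏ⁾ = a`, by rescaling with the weight
`ρ ^ k`, under which `k`-th derivatives keep their values. The limit function satisfies
`g = 0 ↔ g⁽ᵏ⁾ = a`, and `g⁽ᵏ⁾` omits `b`, because `f = e` makes the rescaled value `e / ρ ^ k`
unbounded. -/
theorem exists_sphericalDeriv_le_of_zeros_share {𝓕 : Set (ℂ → ℂ)} {z₀ : ℂ} {r : ℝ} (hr : 0 < r)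
    {k : ℕ} (hk : 1 ≤ k) {a b e : ℂ} (hb : b ≠ 0) (hab : a ≠ b) (he : e ≠ 0)
    (hka : k = 1 ∨ a = 0)
    (hdiff : ∀ f ∈ 𝓕, DifferentiableOn ℂ f (ball z₀ r))
    (hmult : ∀ f ∈ 𝓕, ZerosMultiplicityGeOn f k (ball z₀ r))
    (hshare : ∀ f ∈ 𝓕, ∀ z ∈ ball z₀ r, f z = 0 ↔ iteratedDeriv k f z = a)
    (hval : ∀ f ∈ 𝓕, ∀ z ∈ ball z₀ r, iteratedDeriv k f z = b → f z = e) :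
    ∃ s > 0, ∃ M : ℝ, ∀ f ∈ 𝓕, ∀ p ∈ ball z₀ s, sphericalDeriv f p ≤ M := by
  by_contra! hunb
  have hB : 0 < ‖a‖ + 1 := by positivity
  obtain ⟨f, z, ρ, g, h, hg, hgM, hg0⟩ := exists_isZalcmanLimit (α := k) hr hB hdiff
    (by
      intro f hf z hz
      have hfa := (hdiff f hf).analyticAt (isOpen_ball.mem_nhds hz)
      by_cases hfz : f z = 0
      · have hka' := (hshare f hf z hz).1 hfz
        rcases hka with rfl | rfl
        · refine eventually_scaledSphericalDeriv_one_lt hfa ?_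
          rw [← iteratedDeriv_one, hka']
          exact lt_add_one _
        · refine eventually_scaledSphericalDeriv_lt_of_lt_order hB hfa ?_
          rw [natCast_le_analyticOrderAt_iff_iteratedDeriv_eq_zero hfa]
          intro i hi
          rcases (Nat.lt_succ_iff.1 hi).lt_or_eq with hi | rfl
          · exact (natCast_le_analyticOrderAt_iff_iteratedDeriv_eq_zero hfa).1
              (hmult f hf z hz hfz) i hi
          · exact hka'
      · exact eventually_scaledSphericalDeriv_lt_of_ne_zero hB hfa hfz) hunb
  have hne := exists_ne_of_sphericalDeriv_pos (hB.trans_le hg0)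
  have hρk : ∀ n, (ρ n : ℂ) ^ k ≠ 0 := fun n => pow_ne_zero k (h.ofReal_ne_zero n)
  have hzero : ∀ ζ, g ζ = 0 → ∀ j < k, iteratedDeriv j g ζ = 0 := fun ζ hζ j hj =>
    h.iteratedDeriv_eq_zero_of_multiplicity hdiff hg hmult (hne 0) hζ hj
  have hga : ∀ ζ, g ζ = 0 → iteratedDeriv k g ζ = a := by
    intro ζ hζ
    refine h.iteratedDeriv_eq_of_imp hdiff hg 0 k (c := fun _ => 0) (d := fun _ => a)
      (by simpa [hζ] using hne 0) (by simp [hζ]) tendsto_const_nhds fun n w hw hfw => ?_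
    have hfw0 : f n w = 0 := by simpa [h.ofReal_ne_zero n] using hfw
    rw [div_self (hρk n), one_mul, (hshare _ (h.mem n) w hw).1 hfw0]
  -- the `k`-th derivative of the limit is not constant
  have hnek : ∀ c, ∃ ζ, iteratedDeriv k g ζ ≠ c := by
    intro c
    by_contra! hcon
    obtain ⟨z₁, hz₁⟩ := exists_eq_zero_of_iteratedDeriv_eq hg hcon hne
    have hca : c = a := (hcon z₁).symm.trans (hga z₁ hz₁)
    rw [hca] at hcon
    rcases hka with rfl | rfl
    · have h1 : sphericalDeriv g 0 ≤ ‖a‖ := by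
        unfold sphericalDeriv
        rw [← iteratedDeriv_one, hcon]
        exact div_le_self (norm_nonneg a) (by linarith [sq_nonneg ‖g 0‖])
      linarith
    · obtain ⟨ζ, hζ⟩ := hne 0
      exact hζ (eq_zero_of_iteratedDeriv_eq_zero hg hcon (hzero z₁ hz₁) ζ)
  have hag : ∀ ζ, iteratedDeriv k g ζ = a → g ζ = 0 := by
    intro ζ hζ
    have := h.iteratedDeriv_eq_of_imp hdiff hg k 0 (c := fun _ => a) (d := fun _ => 0)
      (ζ₀ := ζ) (by simpa [hζ] using hnek a) (by simp [hζ]) tendsto_const_nhds fun n w hw hfw => by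
        rw [div_self (hρk n), one_mul] at hfw
        simp [(hshare _ (h.mem n) w hw).2 hfw]
    simpa using this
  have hgb : ∀ ζ, iteratedDeriv k g ζ ≠ b := by
    intro ζ hζ
    -- multiplying the rescaled functions by `ρ ^ k` gives functions tending to `0`
    have hlim : TendstoLocallyUniformlyOn (fun n ζ => (ρ n : ℂ) ^ k *
        (f n (z n + ρ n * ζ) / (ρ n : ℂ) ^ k)) (fun ζ => 0 * g ζ) atTop Set.univ :=
      TendstoLocallyUniformlyOn.fun_mul₀
        ((h.tendsto_ofReal_pow hk).tendstoUniformlyOn_const Set.univ).tendstoLocallyUniformlyOn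
        h.tendsto continuousOn_const hg.continuous.continuousOn
    have := eq_of_eventually_exists_mem_ball_eq hlim (ζ₀ := ζ) (c := fun _ => e) (d := e)
      (continuous_const.mul hg.continuous).continuousAt tendsto_const_nhds fun ε hε => by
        filter_upwards [h.eventually_exists_iteratedDeriv_eq hdiff hg k (ζ₀ := ζ)
          (c := fun _ => b) (by simpa [hζ] using hnek b) (by simp [hζ]) hε] with n hn
        obtain ⟨ξ, hξ, hmem, hξb⟩ := hn
        rw [div_self (hρk n), one_mul] at hξb
        exact ⟨ξ, hξ, by rw [mul_div_cancel₀ _ (hρk n), hval _ (h.mem n) _ hmem hξb]⟩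
    rw [zero_mul] at this
    exact he this.symm
  obtain ⟨A, hA, hgA⟩ := exists_norm_le_exp_of_sphericalDeriv_le hg hgM
  obtain ⟨A', hA', hgA'⟩ := exists_norm_iteratedDeriv_le_exp hg hA hgA k
  have hgk : Differentiable ℂ (iteratedDeriv k g) :=
    (hg.contDiff (n := ⊤)).differentiable_iteratedDeriv k (by exact_mod_cast WithTop.coe_lt_top _)
  obtain ⟨α, β, hαβ⟩ := exists_eq_const_add_exp hgk hA' hgA' hgb
  have hα : α ≠ 0 := by
    rintro rfl
    obtain ⟨ζ, hζ⟩ := hnek (b + Complex.exp β)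
    exact hζ (by simpa using hαβ ζ)
  obtain ⟨ζ, hζa, hζ0⟩ := exists_iteratedDeriv_eq_ne_zero hg hk hα hab hb hαβ
  exact hζ0 (hag ζ hζa)

theorem iteratedDeriv_sub_const {k : ℕ} (hk : 1 ≤ k) (f : ℂ → ℂ) (a : ℂ) :
    iteratedDeriv k (fun z => f z - a) = iteratedDeriv k f := by
  obtain ⟨j, rfl⟩ : ∃ j, k = j + 1 := ⟨k - 1, by omega⟩
  rw [iteratedDeriv_succ', iteratedDeriv_succ']
  congr 1
  exact funext fun z => deriv_sub_const a

theorem sphericalDeriv_le_mul_sub_const (f : ℂ → ℂ) (a z : ℂ) :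
    sphericalDeriv f z ≤ 2 * (1 + ‖a‖ ^ 2) * sphericalDeriv (fun z => f z - a) z := by
  unfold sphericalDeriv
  rw [deriv_sub_const, ← mul_div_assoc, div_le_div_iff₀ (by positivity) (by positivity)]
  have h1 : 1 + ‖f z - a‖ ^ 2 ≤ 2 * (1 + ‖a‖ ^ 2) * (1 + ‖f z‖ ^ 2) := by
    have h2 : ‖f z - a‖ ^ 2 ≤ (‖f z‖ + ‖a‖) ^ 2 := by gcongr; exact norm_sub_le _ _
    nlinarith [sq_nonneg (‖f z‖ - ‖a‖), mul_nonneg (sq_nonneg ‖a‖) (sq_nonneg ‖f z‖)]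
  calc ‖deriv f z‖ * (1 + ‖f z - a‖ ^ 2)
      ≤ ‖deriv f z‖ * (2 * (1 + ‖a‖ ^ 2) * (1 + ‖f z‖ ^ 2)) := by gcongr
    _ = _ := by ring

/-- For `k = 1` or `a = 0` the functions `f - a` still have zeros of multiplicity at least `k`, so
they fall under `exists_sphericalDeriv_le_of_zeros_share`. -/
theorem exists_sphericalDeriv_le {𝓕 : Set (ℂ → ℂ)} {z₀ : ℂ} {r : ℝ} (hr : 0 < r)
    {k : ℕ} (hk : 1 ≤ k) {a b : ℂ} (hab : a ≠ b) (hb : b ≠ 0)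
    (hdiff : ∀ f ∈ 𝓕, DifferentiableOn ℂ f (ball z₀ r))
    (hmult : ∀ f ∈ 𝓕, ZerosMultiplicityGeOn f k (ball z₀ r))
    (hshare : ∀ f ∈ 𝓕, SharesValueIMOn f (iteratedDeriv k f) a (ball z₀ r))
    (hval : ∀ f ∈ 𝓕, ∀ z ∈ ball z₀ r, iteratedDeriv k f z = b → f z = b) :
    ∃ s > 0, ∃ M : ℝ, ∀ f ∈ 𝓕, ∀ p ∈ ball z₀ s, sphericalDeriv f p ≤ M := by
  by_cases hka : k = 1 ∨ a = 0
  · obtain ⟨s, hs, M, hM⟩ := exists_sphericalDeriv_le_of_zeros_share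
      (𝓕 := (fun f z => f z - a) '' 𝓕) hr hk hb hab (sub_ne_zero.2 hab.symm) hka
      (by
        rintro _ ⟨f, hf, rfl⟩
        exact (hdiff f hf).sub_const a)
      (by
        rintro _ ⟨f, hf, rfl⟩ z hz hfz
        rcases hka with rfl | rfl
        · have ha := ((hdiff f hf).sub_const a).analyticAt (isOpen_ball.mem_nhds hz)
          rw [Nat.cast_one, Order.one_le_iff_ne_zero]
          exact ha.analyticOrderAt_ne_zero.2 hfz
        · simp only [sub_zero] at hfz ⊢
          exact hmult f hf z hz hfz)
      (by
        rintro _ ⟨f, hf, rfl⟩ z hz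
        simp only [iteratedDeriv_sub_const hk, sub_eq_zero]
        exact hshare f hf z hz)
      (by
        rintro _ ⟨f, hf, rfl⟩ z hz hfz
        simp only [iteratedDeriv_sub_const hk] at hfz ⊢
        rw [hval f hf z hz hfz])
    refine ⟨s, hs, 2 * (1 + ‖a‖ ^ 2) * M, fun f hf p hp => ?_⟩
    refine (sphericalDeriv_le_mul_sub_const f a p).trans ?_
    gcongr
    exact hM _ ⟨f, hf, rfl⟩ p hp
  · push Not at hka
    exact exists_sphericalDeriv_le_of_two_le hr (by omega) hka.2 hab hdiff hmult
      (fun f hf z hz => (hshare f hf z hz).1) hval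

/-! ### Normality of the family -/

theorem theorem2p1 (D : Set ℂ) (hDopen : IsOpen D) (hDconn : IsConnected D)
    (k : ℕ) (hk : 1 ≤ k) (a b : ℂ) (hab : a ≠ b) (hb : b ≠ 0)
    (F : Set (ℂ → ℂ))
    (hhol : ∀ f ∈ F, DifferentiableOn ℂ f D)
    (hmult : ∀ f ∈ F, ZerosMultiplicityGeOn f k D)
    (hshare : ∀ f ∈ F, SharesValueIMOn f (iteratedDeriv k f) a D)
    (hval : ∀ f ∈ F, ∀ z ∈ D, iteratedDeriv k f z = b → f z = b) :
    IsNormalFamilyOn F D := by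
  intro f hf
  obtain ⟨φ, hφ, hlim⟩ := exists_subseq_of_sphericalDeriv_le hDopen hDconn (f := f) (by
    intro z₀ hz₀
    obtain ⟨r, hr, hsub⟩ := Metric.isOpen_iff.1 hDopen z₀ hz₀
    obtain ⟨s, hs, M, hM⟩ := exists_sphericalDeriv_le (𝓕 := F) hr hk hab hb
      (fun f hf => (hhol f hf).mono hsub) (fun f hf z hz => hmult f hf z (hsub hz))
      (fun f hf z hz => hshare f hf z (hsub hz)) (fun f hf z hz => hval f hf z (hsub hz))
    exact ⟨min r s, lt_min hr hs, M, Eventually.of_forall fun n =>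
      ⟨(hhol _ (hf n)).mono ((ball_subset_ball (min_le_left _ _)).trans hsub),
        fun w hw => hM _ (hf n) w (ball_subset_ball (min_le_right _ _) hw)⟩⟩)
  refine ⟨φ, hφ, hlim.imp (fun ⟨g, hg⟩ => ⟨g, fun K hKD hK =>
    (tendstoLocallyUniformlyOn_iff_forall_isCompact hDopen).1 hg K hKD hK⟩) ?_⟩
  intro hinf K hKD hK M
  refine hK.induction_on (p := fun K => ∀ᶠ n in atTop, ∀ z ∈ K, M < ‖f (φ n) z‖) (by simp)
    (fun s t hst ht => ht.mono fun n hn z hz => hn z (hst hz)) (fun s t hs ht => ?_) fun z hz => ?_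
  · filter_upwards [hs, ht] with n h1 h2 z hz
    exact hz.elim (h1 z) (h2 z)
  · obtain ⟨s, hs, hC⟩ := hinf z (hKD hz)
    exact ⟨ball z s, mem_nhdsWithin_of_mem_nhds (ball_mem_nhds z hs), hC M⟩
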